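/- **Conventions.** For a $p\times q$ matrix $M$ ($1\le p\le q$) over a commutative ring, with columns $M_1,\dots,M_q$, let $\operatorname{dp}(M)=\sum_{j=0}^{q-p}c_jx^j$ with $c_j=\det[M_1\ \cdots\ M_{p-1}\ M_{q-j}]$. For a list $P=(P_1,\dots,P_t)$ of univariate polynomials with $m=\max_s\deg P_s$, let $\operatorname{cm}(P)$ be the $t\times(m+1)$ matrix whose $(s,l)$ entry is the coefficient of $x^{m+1-l}$ in $P_s$ (the empty list gives a matrix with $0$ columns). Let $n\ge 1$ and let $G=(G_0,\dots,G_n)$ be univariate polynomials. For $\delta=(\delta_1,\dots,\delta_n)\in\mathbb N^n$ put $|\delta|=\delta_1+\cdots+\delta_n$, and let $P(D,n)=\{\delta\in\mathbb N^n: |\delta|\le D\}$. For $\delta\in P(\deg G_0,n)$ write $\mathcal G_j=(x^{\delta_j-1}G_j,\dots,x^0G_j)$, and let $c(\delta)$ be the number of columns of $\operatorname{cm}(\mathcal G_1,\dots,\mathcal G_n)$. Put $\delta_0=c(\delta)-\deg G_0$ if $c(\delta)\ge\deg G_0$, and $\delta_0=1$ otherwise. The $\delta$-subresultant of $G$ and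 its principal coefficient are $$R_\delta(G)=\operatorname{dp}\bigl(\operatorname{cm}(\mathcal G_0,\mathcal G_1,\dots,\mathcal G_n)\bigr),\qquad r_\delta(G)=\operatorname{coeff}_{x^{\deg G_0-|\delta|}}R_\delta(G).$$ Let $e_0=(0,\dots,0)\in\mathbb N^n$ and let $e_1,\dots,e_n$ be the unit vectors of $\mathbb N^n$. **Theorem.** Let $n\ge1$, let $d_0,\dots,d_n\in\mathbb N$ with $d_0\le d_j$ for all $j$, and let $F=(F_0,\dots,F_n)$ be the generic polynomials $F_j=\sum_{l=0}^{d_j}a_{jl}x^l$, where $F_0$ is monic ($a_{0d_0}=1$) and all the other $a_{jl}$ are independent indeterminates over $\mathbb Z$. Let $k\ge1$, $0\le i\le n$ and $w_0\in\mathbb N^n$, and put $$w_j=w_0+e_j\ (1\le j\le n),\qquad v=(k,\dots,k)+e_i,\qquad u=w_0+v,\qquad \epsilon=|v+e_i|+k-2 .$$ If $u\in P(d_0,n)$, then $$r_{w_0}(F)^{\epsilon}\;R_u(F)=R_v\bigl(R_{w_0}(F),R_{w_1}(F),\dots,R_{w_n}(F)\bigr).$$ -/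

import Mathlib

open Polynomial

/-- Determinant polynomial `∑_{0 ≤ j ≤ q - p} c_j x^j` of a `p × q` matrix, `1 ≤ p ≤ q`, where
`c_j = det [M_1 ⋯ M_{p-1} M_{q-j}]` (columns numbered from 1).  With columns numbered from 0, the
last one is the column `q - 1 - j`.  For `q < p` it is set to `0`. -/
noncomputable def detPoly {A : Type*} [CommRing A] {p q : ℕ} (M : Matrix (Fin p) (Fin q) A) :
    A[X] :=
  if h : p ≤ q then
    ∑ j ∈ Finset.range (q - p + 1),
      C (Matrix.det (Matrix.of fun s l : Fin p =>
        M s (if l.val + 1 < p then ⟨l.val, by omega⟩ else ⟨q - 1 - j, by have := l.isLt; omega⟩))) * X ^ j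
  else 0

/-- Number of columns of the coefficient matrix of a list of polynomials: the maximum of
`deg P_i + 1`, which is `0` for the empty list. -/
noncomputable def numCols {A : Type*} [CommRing A] (P : List A[X]) : ℕ :=
  (P.map fun f => f.natDegree + 1).foldr max 0

/-- Coefficient matrix of a list of polynomials, one row for each polynomial, with the
coefficients in the order of falling powers of `x`. -/
noncomputable def coeffMatrix {A : Type*} [CommRing A] (P : List A[X]) :
    Matrix (Fin P.length) (Fin (numCols P)) A :=
  Matrix.of fun s l => (P.get s).coeff (numCols P - 1 - l.val)

/-- The list `x^{m-1} f, …, x^0 f`. -/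
noncomputable def shifts {A : Type*} [CommRing A] (m : ℕ) (f : A[X]) : List A[X] :=
  (List.range m).reverse.map fun j => X ^ j * f

/-- The concatenation of the lists `x^{δ_j-1} F_j, …, x^0 F_j` for `j = 1, …, n`. -/
noncomputable def tailList {A : Type*} [CommRing A] {n : ℕ} (F : Fin (n + 1) → A[X])
    (δ : Fin n → ℕ) : List A[X] :=
  (List.ofFn fun j : Fin n => shifts (δ j) (F j.succ)).flatten

/-- The number `δ_0` that belongs to `δ = (δ_1, …, δ_n)`. -/
noncomputable def deltaZero {A : Type*} [CommRing A] {n : ℕ} (F : Fin (n + 1) → A[X])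
    (δ : Fin n → ℕ) : ℕ :=
  if (F 0).natDegree ≤ numCols (tailList F δ) then
    numCols (tailList F δ) - (F 0).natDegree
  else 1

/-- The `δ`-subresultant `R_δ(F)` of `F = (F_0, …, F_n)`. -/
noncomputable def subres {A : Type*} [CommRing A] {n : ℕ} (δ : Fin n → ℕ)
    (F : Fin (n + 1) → A[X]) : A[X] :=
  detPoly (coeffMatrix (shifts (deltaZero F δ) (F 0) ++ tailList F δ))

/-- The principal coefficient `r_δ(F)`: the coefficient of `x^{deg F_0 - |δ|}` in `R_δ(F)`. -/
noncomputable def princCoeff {A : Type*} [CommRing A] {n : ℕ} (δ : Fin n → ℕ)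
    (F : Fin (n + 1) → A[X]) : A :=
  (subres δ F).coeff ((F 0).natDegree - ∑ j, δ j)

/-- `P(d₀, n)`: the vectors `δ ∈ ℕ^n` with `|δ| ≤ d₀`. -/
def indexSet (d₀ n : ℕ) : Set (Fin n → ℕ) :=
  {δ | ∑ j, δ j ≤ d₀}

/-- `e_0 = 0`, and `e_1, …, e_n` are the unit vectors of length `n`. -/
def unitVec (n : ℕ) (i : Fin (n + 1)) : Fin n → ℕ :=
  fun j => if i = j.succ then 1 else 0

/-- The generic polynomials `F_i = ∑_{0 ≤ j ≤ d_i} a_{ij} x^j`, `0 ≤ i ≤ n`, whose coefficients are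
independent indeterminates `a_{ij}`, except that `F_0` is monic, i.e. `a_{0 d_0} = 1`. -/
noncomputable def genericFamily {n : ℕ} (d : Fin (n + 1) → ℕ) (i : Fin (n + 1)) :
    (MvPolynomial (Fin (n + 1) × ℕ) ℤ)[X] :=
  ∑ j ∈ Finset.range (d i + 1),
    C (if i = 0 ∧ j = d 0 then 1 else MvPolynomial.X (i, j)) * X ^ j

/-! Rows are multiplied in the exterior algebra of `R[X]`. The determinant polynomial and the
leading maximal minor become linear forms `dpForm` and `topForm`, and row operations become
identities between products.

Let A_N be the rows of the subresultant at w_0, with N rows coming from F_0. As F_0 is monic, a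
large enough N may be enlarged further without changing minors or determinant polynomials
(`topForm_rowList_eq`, `dpForm_rowList_eq`). Let G be this subresultant, r its principal
coefficient, E_j the next row of block j, that is, F_j times x to the j-th entry of w_0, and H_j the
determinant polynomial of A_N with E_j appended, which is the subresultant at w_j up to sign.
Cofactor expansion shows that G lies in the span of A_N and that H_j is congruent to r E_j modulo
this span; moreover each H_j has smaller degree than G.

The engine is `wedge_step`: (x A_N) ∧ G ∧ H_1 ∧ … ∧ H_n = r^(n+1) A_(N+1) ∧ E_1 ∧ … ∧ E_n. Modulo
the H_j, the list x A_N, G lies in the span of A_(N+1) and has the same length; the leading minors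
are r² and r, which gives one factor r, and each H_j gives another. Multiplication by powers of x
and iteration (`wedge_levels`, `wedge_blocks`) turn x^m A_N followed by the rows of the subresultant
at v of (G, H) into the rows at u, with factor r^(m+|v|). Under `dpForm` the rows x^m A_N split off
as a triangular block with minor r, and cancelling one r leaves the exponent ε.

The cancellation needs r ≠ 0, which follows from a specialization to monomials
(`topForm_genericFamily_ne_zero`), and takes place over the fraction field. The signs from sorting
rows agree on both sides (`wedge_blocks_add`, `wedge_blocks_smul`). -/

/-! ### Exterior products of lists of polynomials -/

section Wedge

variable {R : Type*} [CommRing R]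

/-- The exterior product of a list of polynomials. -/
noncomputable def wedge (L : List R[X]) : ExteriorAlgebra R R[X] :=
  (L.map (ExteriorAlgebra.ι R)).prod

@[simp] theorem wedge_nil : wedge ([] : List R[X]) = 1 := rfl

theorem wedge_cons (a : R[X]) (L : List R[X]) :
    wedge (a :: L) = ExteriorAlgebra.ι R a * wedge L := by simp [wedge]

theorem wedge_append (L L' : List R[X]) : wedge (L ++ L') = wedge L * wedge L' := by
  simp [wedge]

theorem wedge_ofFn {p : ℕ} (P : Fin p → R[X]) :
    wedge (List.ofFn P) = ExteriorAlgebra.ιMulti R p P := by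
  rw [ExteriorAlgebra.ιMulti_apply, wedge, List.map_ofFn]; rfl

theorem ι_mul_ι_swap (a b : R[X]) :
    ExteriorAlgebra.ι R a * ExteriorAlgebra.ι R b =
      -(ExteriorAlgebra.ι R b * ExteriorAlgebra.ι R a) :=
  eq_neg_of_add_eq_zero_left (ExteriorAlgebra.ι_add_mul_swap a b)

theorem ι_mul_wedge (a : R[X]) (L : List R[X]) :
    ExteriorAlgebra.ι R a * wedge L = (-1) ^ L.length * (wedge L * ExteriorAlgebra.ι R a) := by
  induction L with
  | nil => simp
  | cons b L ih =>
    rw [wedge_cons, ← mul_assoc, ι_mul_ι_swap, neg_mul, mul_assoc, ih, List.length_cons, pow_succ,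
      ← mul_assoc, ← mul_assoc]
    rw [← ((Commute.neg_one_left (ExteriorAlgebra.ι R b)).pow_left L.length).eq]
    simp [mul_assoc]

theorem wedge_mul_wedge (L L' : List R[X]) :
    wedge L * wedge L' = (-1) ^ (L.length * L'.length) * (wedge L' * wedge L) := by
  induction L with
  | nil => simp
  | cons b L ih =>
    rw [wedge_cons, mul_assoc, ih, ← mul_assoc,
      ← ((Commute.neg_one_left (ExteriorAlgebra.ι R b)).pow_left _).eq, mul_assoc,
      ← mul_assoc _ (wedge L'), ι_mul_wedge, List.length_cons, add_mul, pow_add, one_mul]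
    simp [mul_assoc]

/-- The exterior product of a list vanishes when multiplied by an element of its span. -/
theorem ι_mul_wedge_eq_zero {a : R[X]} {L : List R[X]}
    (h : a ∈ Submodule.span R {b | b ∈ L}) : ExteriorAlgebra.ι R a * wedge L = 0 := by
  induction h using Submodule.span_induction with
  | mem x hx =>
    obtain ⟨s, t, rfl⟩ := List.append_of_mem hx
    rw [wedge_append, wedge_cons, ← mul_assoc, ι_mul_wedge, mul_assoc, mul_assoc,
      ← mul_assoc (ExteriorAlgebra.ι R x)]
    simp
  | zero => simp
  | add x y _ _ hx hy => rw [map_add, add_mul, hx, hy, add_zero]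
  | smul c x _ hx => rw [map_smul, smul_mul_assoc, hx, smul_zero]

theorem wedge_mul_ι_eq_zero {a : R[X]} {L : List R[X]}
    (h : a ∈ Submodule.span R {b | b ∈ L}) : wedge L * ExteriorAlgebra.ι R a = 0 := by
  have h1 := ι_mul_wedge a L
  rw [ι_mul_wedge_eq_zero h] at h1
  have h2 : ((-1 : ExteriorAlgebra R R[X]) ^ L.length) *
      ((-1) ^ L.length * (wedge L * ExteriorAlgebra.ι R a)) = 0 := by rw [← h1, mul_zero]
  rwa [← mul_assoc, ← pow_add, (Even.add_self _).neg_one_pow, one_mul] at h2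

/-- Multiplication by `X ^ m` on the exterior algebra. -/
noncomputable def shiftHom (m : ℕ) : ExteriorAlgebra R R[X] →ₐ[R] ExteriorAlgebra R R[X] :=
  ExteriorAlgebra.map (LinearMap.mulLeft R (X ^ m))

theorem shiftHom_wedge (m : ℕ) (L : List R[X]) :
    shiftHom m (wedge L) = wedge (L.map (X ^ m * ·)) := by
  simp only [shiftHom, wedge, map_list_prod, List.map_map]
  congr 1
  apply List.map_congr_left
  intro a _
  simp

/-- A permutation of the index list changes the exterior product by a sign that does not depend
on the family. -/
theorem exists_sign_wedge_map {ι : Type*} {l l' : List ι} (h : l.Perm l') :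
    ∃ s : ℤˣ, ∀ f : ι → R[X], wedge (l.map f) = ((s : ℤ) : ExteriorAlgebra R R[X]) *
      wedge (l'.map f) := by
  induction h with
  | nil => exact ⟨1, fun f => by simp⟩
  | @cons x l l' _ ih =>
    obtain ⟨s, hs⟩ := ih
    refine ⟨s, fun f => ?_⟩
    rw [List.map_cons, List.map_cons, wedge_cons, wedge_cons, hs, ← mul_assoc, ← mul_assoc,
      (Int.cast_commute (s : ℤ) _).eq]
  | swap x y l =>
    refine ⟨-1, fun f => ?_⟩
    simp only [List.map_cons, wedge_cons, ← mul_assoc]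
    rw [ι_mul_ι_swap]
    simp [mul_assoc]
  | trans _ _ ih₁ ih₂ =>
    obtain ⟨s, hs⟩ := ih₁
    obtain ⟨t, ht⟩ := ih₂
    exact ⟨s * t, fun f => by rw [hs, ht, ← mul_assoc]; simp⟩

end Wedge

/-! ### Determinant polynomials and leading minors as linear forms -/

section Forms

variable {R : Type*} [CommRing R]

/-- The coefficients of a polynomial that enter the coefficient of `X ^ j` of the determinant
polynomial of a `p × q` matrix. -/
noncomputable def selCoeff (R : Type*) [CommRing R] (q p j : ℕ) : R[X] →ₗ[R] (Fin p → R) :=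
  LinearMap.pi fun l => lcoeff R (if l.val + 1 < p then q - 1 - l.val else j)

/-- The leading `p` coefficients of a polynomial of degree less than `q`. -/
noncomputable def topCoeff (R : Type*) [CommRing R] (q p : ℕ) : R[X] →ₗ[R] (Fin p → R) :=
  LinearMap.pi fun l => lcoeff R (q - 1 - l.val)

/-- The determinant polynomial as an alternating map in the rows. -/
noncomputable def dpAlt (R : Type*) [CommRing R] (q p : ℕ) : R[X] [⋀^Fin p]→ₗ[R] R[X] :=
  ∑ j ∈ Finset.range (q - p + 1), (monomial j).compAlternatingMap
    (Matrix.detRowAlternating.compLinearMap (selCoeff R q p j))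

/-- The determinant polynomial of the coefficient matrix with `q` columns, as a linear form on the
exterior algebra. -/
noncomputable def dpForm (R : Type*) [CommRing R] (q : ℕ) : ExteriorAlgebra R R[X] →ₗ[R] R[X] :=
  ExteriorAlgebra.liftAlternating fun p => dpAlt R q p

/-- The leading maximal minor of the coefficient matrix with `q` columns, as a linear form on the
exterior algebra. -/
noncomputable def topForm (R : Type*) [CommRing R] (q : ℕ) : ExteriorAlgebra R R[X] →ₗ[R] R :=
  ExteriorAlgebra.liftAlternating fun p =>
    Matrix.detRowAlternating.compLinearMap (topCoeff R q p)

theorem dpForm_ofFn (q : ℕ) {p : ℕ} (P : Fin p → R[X]) :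
    dpForm R q (wedge (List.ofFn P)) = ∑ j ∈ Finset.range (q - p + 1),
      monomial j (Matrix.of fun s l : Fin p =>
        (P s).coeff (if l.val + 1 < p then q - 1 - l.val else j)).det := by
  rw [wedge_ofFn, dpForm, ExteriorAlgebra.liftAlternating_apply_ιMulti, dpAlt]
  generalize Finset.range (q - p + 1) = t
  induction t using Finset.cons_induction with
  | empty => rfl
  | cons a t ha ih => rw [Finset.sum_cons, AlternatingMap.add_apply, ih, Finset.sum_cons]; rfl

theorem topForm_ofFn (q : ℕ) {p : ℕ} (P : Fin p → R[X]) :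
    topForm R q (wedge (List.ofFn P)) =
      (Matrix.of fun s l : Fin p => (P s).coeff (q - 1 - l.val)).det := by
  rw [wedge_ofFn, topForm, ExteriorAlgebra.liftAlternating_apply_ιMulti]
  rfl

theorem det_append_blocks {p₁ p₂ : ℕ} (P₁ : Fin p₁ → R[X]) (P₂ : Fin p₂ → R[X])
    (c : ℕ → ℕ) (h : ∀ s : Fin p₂, ∀ l < p₁, (P₂ s).coeff (c l) = 0) :
    (Matrix.of fun s l : Fin (p₁ + p₂) => (Fin.append P₁ P₂ s).coeff (c l)).det =
      (Matrix.of fun s l : Fin p₁ => (P₁ s).coeff (c l)).det *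
      (Matrix.of fun s l : Fin p₂ => (P₂ s).coeff (c (p₁ + l))).det := by
  rw [← Matrix.det_reindex_self finSumFinEquiv.symm, ← Matrix.det_fromBlocks_zero₂₁ _
    (Matrix.of fun (s : Fin p₁) (l : Fin p₂) => (P₁ s).coeff (c (p₁ + l)))]
  congr 1
  ext a b
  rcases a with a | a <;> rcases b with b | b <;> simp [h]

theorem dpForm_append {q : ℕ} (L₁ L₂ : List R[X]) (h₂ : L₂ ≠ [])
    (hq : L₁.length + L₂.length ≤ q) (hL : ∀ f ∈ L₂, f.degree < (q - L₁.length : ℕ)) :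
    dpForm R q (wedge (L₁ ++ L₂)) =
      topForm R q (wedge L₁) • dpForm R (q - L₁.length) (wedge L₂) := by
  obtain ⟨p₁, P₁, rfl⟩ : ∃ p, ∃ P : Fin p → R[X], L₁ = List.ofFn P := ⟨_, _, (List.ofFn_get L₁).symm⟩
  obtain ⟨p₂, P₂, rfl⟩ : ∃ p, ∃ P : Fin p → R[X], L₂ = List.ofFn P := ⟨_, _, (List.ofFn_get L₂).symm⟩
  have hp₂ : 0 < p₂ := by
    rcases Nat.eq_zero_or_pos p₂ with h | h
    · subst h; simp at h₂
    · exact h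
  simp only [List.length_ofFn] at hq hL ⊢
  rw [← List.ofFn_fin_append, dpForm_ofFn, dpForm_ofFn, topForm_ofFn, Finset.smul_sum,
    Nat.sub_add_eq]
  refine Finset.sum_congr rfl fun j hj => ?_
  rw [Finset.mem_range] at hj
  rw [det_append_blocks P₁ P₂ (fun l => if l + 1 < p₁ + p₂ then q - 1 - l else j), smul_monomial,
    smul_eq_mul]
  · congr 2
    · congr 1
      ext s l
      simp only [Matrix.of_apply]
      rw [if_pos (by omega)]
    · congr 1
      ext s l
      simp only [Matrix.of_apply]
      congr 1
      have := l.isLt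
      split_ifs <;> omega
  · intro s l hl
    refine coeff_eq_zero_of_degree_lt ((hL (P₂ s) (by simp)).trans_le ?_)
    rw [if_pos (by omega)]
    exact_mod_cast (by omega)

theorem topForm_append {q : ℕ} (L₁ L₂ : List R[X])
    (hq : L₁.length + L₂.length ≤ q) (hL : ∀ f ∈ L₂, f.degree < (q - L₁.length : ℕ)) :
    topForm R q (wedge (L₁ ++ L₂)) =
      topForm R q (wedge L₁) * topForm R (q - L₁.length) (wedge L₂) := by
  obtain ⟨p₁, P₁, rfl⟩ : ∃ p, ∃ P : Fin p → R[X], L₁ = List.ofFn P := ⟨_, _, (List.ofFn_get L₁).symm⟩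
  obtain ⟨p₂, P₂, rfl⟩ : ∃ p, ∃ P : Fin p → R[X], L₂ = List.ofFn P := ⟨_, _, (List.ofFn_get L₂).symm⟩
  simp only [List.length_ofFn] at hq hL ⊢
  rw [← List.ofFn_fin_append, topForm_ofFn, topForm_ofFn, topForm_ofFn,
    det_append_blocks P₁ P₂ (fun l => q - 1 - l)]
  · congr 2
    ext s l
    simp only [Matrix.of_apply]
    congr 1
    omega
  · intro s l hl
    refine coeff_eq_zero_of_degree_lt ((hL (P₂ s) (by simp)).trans_le ?_)
    exact_mod_cast (by omega)

/-- For this exponent the variable last column is just the next of the leading columns. -/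
theorem coeff_dpForm {q : ℕ} (L : List R[X]) (hL : L ≠ []) (hq : L.length ≤ q) :
    (dpForm R q (wedge L)).coeff (q - L.length) = topForm R q (wedge L) := by
  obtain ⟨p, P, rfl⟩ : ∃ p, ∃ P : Fin p → R[X], L = List.ofFn P := ⟨_, _, (List.ofFn_get L).symm⟩
  have hp : 0 < p := by
    rcases Nat.eq_zero_or_pos p with h | h
    · subst h; simp at hL
    · exact h
  simp only [List.length_ofFn] at hq ⊢
  rw [dpForm_ofFn, topForm_ofFn, finsetSum_coeff, Finset.sum_eq_single (q - p)]
  · rw [coeff_monomial_same]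
    congr 1
    ext s l
    simp only [Matrix.of_apply]
    congr 1
    have := l.isLt
    split_ifs <;> omega
  · intro j _ hj
    rw [coeff_monomial, if_neg hj]
  · intro h
    simp at h

theorem natDegree_dpForm_le (q : ℕ) (L : List R[X]) :
    (dpForm R q (wedge L)).natDegree ≤ q - L.length := by
  obtain ⟨p, P, rfl⟩ : ∃ p, ∃ P : Fin p → R[X], L = List.ofFn P := ⟨_, _, (List.ofFn_get L).symm⟩
  rw [dpForm_ofFn, List.length_ofFn]
  refine natDegree_sum_le_of_forall_le _ _ fun j hj => ?_
  rw [Finset.mem_range] at hj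
  exact (natDegree_monomial_le _).trans (by omega)

/-- Cofactor expansion of the determinant polynomial along its last column. -/
theorem dpForm_ofFn_succ {q p : ℕ} (P : Fin (p + 1) → R[X]) (hq : p + 1 ≤ q)
    (hP : ∀ s, (P s).degree < q) :
    dpForm R q (wedge (List.ofFn P)) = ∑ s : Fin (p + 1),
      ((-1) ^ (s.val + p) * (Matrix.of fun (a : Fin p) (l : Fin p) =>
        (P (s.succAbove a)).coeff (q - 1 - l)).det) • P s := by
  have key : ∀ j, (Matrix.of fun s l : Fin (p + 1) =>
        (P s).coeff (if l.val + 1 < p + 1 then q - 1 - l.val else j)).det =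
      (∑ s : Fin (p + 1), ((-1) ^ (s.val + p) * (Matrix.of fun (a : Fin p) (l : Fin p) =>
        (P (s.succAbove a)).coeff (q - 1 - l)).det) • P s).coeff j := by
    intro j
    rw [Matrix.det_succ_column _ (Fin.last p), finsetSum_coeff]
    refine Finset.sum_congr rfl fun s _ => ?_
    rw [coeff_smul, smul_eq_mul, Matrix.of_apply, if_neg (by simp), Fin.val_last]
    rw [mul_right_comm]
    congr 3
    ext a l
    simp
  rw [dpForm_ofFn]
  ext j
  rw [finsetSum_coeff]
  simp only [coeff_monomial, Finset.sum_ite_eq', Finset.mem_range]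
  split_ifs with hj
  · exact key j
  -- Beyond the range of summation the determinant repeats one of the fixed columns, and for `j ≥ q`
  -- all rows have coefficient zero; so the truncated sum loses nothing.
  · by_cases hjq : j < q
    · rw [← key]
      symm
      refine Matrix.det_zero_of_column_eq (i := ⟨q - 1 - j, by omega⟩) (j := Fin.last p) ?_ ?_
      · intro h
        have := congrArg Fin.val h
        simp at this
        omega
      · intro s
        simp only [Matrix.of_apply, Fin.val_last, lt_self_iff_false, if_false]
        rw [if_pos (by omega)]
        congr 1
        omega
    · rw [finsetSum_coeff]
      symm
      refine Finset.sum_eq_zero fun s _ => ?_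
      rw [coeff_smul, coeff_eq_zero_of_degree_lt ((hP s).trans_le (by exact_mod_cast (not_lt.1 hjq))),
        smul_zero]

theorem dpForm_mem_span {q : ℕ} (L : List R[X]) (h : L ≠ []) (hq : L.length ≤ q)
    (hL : ∀ f ∈ L, f.degree < q) :
    dpForm R q (wedge L) ∈ Submodule.span R {b | b ∈ L} := by
  obtain ⟨p, P, rfl⟩ : ∃ p, ∃ P : Fin p → R[X], L = List.ofFn P := ⟨_, _, (List.ofFn_get L).symm⟩
  rcases p with _ | p
  · simp at h
  rw [dpForm_ofFn_succ P (by simpa using hq) fun s => hL _ (List.mem_ofFn.2 ⟨s, rfl⟩)]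
  exact Submodule.sum_mem _ fun s _ =>
    Submodule.smul_mem _ _ (Submodule.subset_span (List.mem_ofFn.2 ⟨s, rfl⟩))

/-- In the expansion along the last column, the cofactor of the last row is the leading minor of
`L`, with sign `+1`. This is the source of H_j ≡ r E_j. -/
theorem dpForm_append_singleton_sub_mem_span {q : ℕ} (L : List R[X]) (f : R[X])
    (hq : L.length + 1 ≤ q) (hL : ∀ g ∈ L, g.degree < q) (hf : f.degree < q) :
    dpForm R q (wedge (L ++ [f])) - topForm R q (wedge L) • f ∈
      Submodule.span R {b | b ∈ L} := by
  obtain ⟨p, P, rfl⟩ : ∃ p, ∃ P : Fin p → R[X], L = List.ofFn P := ⟨_, _, (List.ofFn_get L).symm⟩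
  have e : List.ofFn P ++ [f] = List.ofFn (Fin.snoc P f : Fin (p + 1) → R[X]) := by
    rw [List.ofFn_succ']
    simp
  rw [e, dpForm_ofFn_succ _ (by simpa using hq), Fin.sum_univ_castSucc, topForm_ofFn]
  · simp only [Fin.snoc_last, Fin.val_last, ← two_mul, pow_mul, Fin.succAbove_last,
      Fin.snoc_castSucc]
    simp only [neg_one_sq, one_pow, one_mul, add_sub_cancel_right]
    exact Submodule.sum_mem _ fun s _ => Submodule.smul_mem _ _ (Submodule.subset_span (by simp))
  · intro s
    refine Fin.lastCases ?_ (fun s => ?_) s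
    · simpa using hf
    · simpa using hL (P s) (by simp)

theorem topForm_map_X_pow_mul (q m : ℕ) (L : List R[X]) (hq : L.length ≤ q) :
    topForm R (q + m) (wedge (L.map (X ^ m * ·))) = topForm R q (wedge L) := by
  obtain ⟨p, P, rfl⟩ : ∃ p, ∃ P : Fin p → R[X], L = List.ofFn P := ⟨_, _, (List.ofFn_get L).symm⟩
  rw [List.length_ofFn] at hq
  rw [List.map_ofFn, topForm_ofFn, topForm_ofFn]
  congr 1
  ext s l
  have : q + m - 1 - l.val = (q - 1 - l.val) + m := by omega
  simp [this, coeff_X_pow_mul]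

theorem map_dpForm {S : Type*} [CommRing S] (φ : R →+* S) (q : ℕ) (L : List R[X]) :
    (dpForm R q (wedge L)).map φ = dpForm S q (wedge (L.map (Polynomial.map φ))) := by
  obtain ⟨p, P, rfl⟩ : ∃ p, ∃ P : Fin p → R[X], L = List.ofFn P := ⟨_, _, (List.ofFn_get L).symm⟩
  rw [List.map_ofFn, dpForm_ofFn, dpForm_ofFn, Polynomial.map_sum]
  refine Finset.sum_congr rfl fun j _ => ?_
  rw [map_monomial, RingHom.map_det]
  congr 2
  ext s l
  simp

theorem map_topForm {S : Type*} [CommRing S] (φ : R →+* S) (q : ℕ) (L : List R[X]) :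
    φ (topForm R q (wedge L)) = topForm S q (wedge (L.map (Polynomial.map φ))) := by
  obtain ⟨p, P, rfl⟩ : ∃ p, ∃ P : Fin p → R[X], L = List.ofFn P := ⟨_, _, (List.ofFn_get L).symm⟩
  rw [List.map_ofFn, topForm_ofFn, topForm_ofFn, RingHom.map_det]
  congr 1
  ext s l
  simp

/-- Bridge from the matrices in the definition of subresultants to the exterior algebra. -/
theorem detPoly_coeffMatrix (L : List R[X]) (h : L ≠ []) (hq : L.length ≤ numCols L) :
    detPoly (coeffMatrix L) = dpForm R (numCols L) (wedge L) := by
  have hp : 0 < L.length := List.length_pos_iff.2 h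
  conv_rhs => rw [show wedge L = wedge (List.ofFn L.get) by rw [List.ofFn_get]]
  rw [dpForm_ofFn, detPoly, dif_pos hq]
  refine Finset.sum_congr rfl fun j hj => ?_
  rw [Finset.mem_range] at hj
  rw [C_mul_X_pow_eq_monomial]
  congr 2
  ext s l
  simp only [Matrix.of_apply, coeffMatrix]
  congr 1
  split_ifs <;> simp only []
  omega

end Forms

/-! ### Row operations in the exterior algebra -/

section ExteriorDeterminant

variable {R : Type*} [CommRing R]

theorem wedge_mul_wedge_smul (L L' : List R[X]) :
    wedge L * wedge L' = ((-1 : R) ^ (L.length * L'.length)) • (wedge L' * wedge L) := by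
  rw [wedge_mul_wedge, Algebra.smul_def, map_pow, map_neg, map_one]

/-- Replacing the rows by linear combinations multiplies the exterior product by the
determinant. -/
theorem wedge_ofFn_sum_smul {p : ℕ} (M : Matrix (Fin p) (Fin p) R) (B : Fin p → R[X]) :
    wedge (List.ofFn fun s => ∑ b, M s b • B b) = M.det • wedge (List.ofFn B) := by
  let β : (Fin p → R) →ₗ[R] R[X] := Fintype.linearCombination R B
  have h : (ExteriorAlgebra.ιMulti R p).compLinearMap β =
      (LinearMap.toSpanSingleton R (ExteriorAlgebra R R[X])
        (wedge (List.ofFn B))).compAlternatingMap Matrix.detRowAlternating := by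
    -- Both sides are alternating in the rows of `M`, so it suffices to compare them on distinct
    -- basis vectors, that is, on permutation matrices.
    refine Module.Basis.ext_alternating (Pi.basisFun R (Fin p)) fun v hv => ?_
    let σ : Equiv.Perm (Fin p) := Equiv.ofBijective v (Finite.injective_iff_bijective.1 hv)
    have e : (fun i => Pi.basisFun R (Fin p) (v i)) = (fun i => Pi.basisFun R (Fin p) i) ∘ σ := rfl
    rw [e, AlternatingMap.map_perm, AlternatingMap.map_perm]
    congr 1
    rw [AlternatingMap.compLinearMap_apply, wedge_ofFn, LinearMap.compAlternatingMap_apply]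
    have h1 : Matrix.detRowAlternating (fun i => Pi.basisFun R (Fin p) i) = 1 := by
      have : (fun i => Pi.basisFun R (Fin p) i) = (1 : Matrix (Fin p) (Fin p) R) := by
        ext i j; simp [Matrix.one_apply, Pi.single_apply, eq_comm]
      rw [this]
      exact Matrix.det_one
    rw [h1, LinearMap.toSpanSingleton_apply, one_smul]
    congr 1
    ext i
    simp [β]
  rw [wedge_ofFn]
  exact DFunLike.congr_fun h (fun s => M s)

/-- Each difference `y - y'` lies in the span of `H`, hence is killed by any product containing
`wedge H`. -/
theorem wedge_mul_wedge_congr {Y Y' H : List R[X]}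
    (h : List.Forall₂ (fun y y' => y - y' ∈ Submodule.span R {b | b ∈ H}) Y Y') :
    wedge Y * wedge H = wedge Y' * wedge H := by
  induction h with
  | nil => rfl
  | @cons y y' Y Y' hy _ ih =>
    have h0 : ExteriorAlgebra.ι R (y - y') * (wedge Y' * wedge H) = 0 := by
      rw [← wedge_append]
      exact ι_mul_wedge_eq_zero (Submodule.span_mono (fun b hb => by
        simp only [Set.mem_ofPred_eq, List.mem_append] at hb ⊢; exact Or.inr hb) hy)
    rw [map_sub, sub_mul, sub_eq_zero] at h0
    rw [wedge_cons, mul_assoc, ih, h0, wedge_cons, mul_assoc]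

/-- Exterior products of two lists that agree modulo a third one are compared through their
leading minors, if the third list does not contribute to these. -/
theorem topForm_smul_wedge_mul_wedge {q : ℕ} {B Y H : List R[X]} (hlen : Y.length = B.length)
    (hY : ∀ y ∈ Y, y ∈ Submodule.span R {b | b ∈ B} ⊔ Submodule.span R {b | b ∈ H})
    (hH : ∀ h ∈ H, ∀ l < B.length, h.coeff (q - 1 - l) = 0) :
    topForm R q (wedge B) • (wedge Y * wedge H) = topForm R q (wedge Y) • (wedge B * wedge H) := by
  obtain ⟨p, B, rfl⟩ : ∃ p, ∃ P : Fin p → R[X], B = List.ofFn P := ⟨_, _, (List.ofFn_get B).symm⟩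
  obtain ⟨p', Y, rfl⟩ : ∃ p, ∃ P : Fin p → R[X], Y = List.ofFn P := ⟨_, _, (List.ofFn_get Y).symm⟩
  simp only [List.length_ofFn] at hlen hH
  subst hlen
  have hs : ∀ s, ∃ c : Fin p' → R, Y s - ∑ b, c b • B b ∈ Submodule.span R {b | b ∈ H} := by
    intro s
    obtain ⟨y, hy, z, hz, e⟩ := Submodule.mem_sup.1 (hY (Y s) (List.mem_ofFn.2 ⟨s, rfl⟩))
    have hr : {b | b ∈ List.ofFn B} = Set.range B := by
      ext b; simp [List.mem_ofFn]
    rw [hr, Submodule.mem_span_range_iff_exists_fun] at hy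
    obtain ⟨c, rfl⟩ := hy
    exact ⟨c, by rw [← e]; simpa using hz⟩
  choose M hM using hs
  have h1 : wedge (List.ofFn Y) * wedge H =
      wedge (List.ofFn fun s => ∑ b, M s b • B b) * wedge H := by
    refine wedge_mul_wedge_congr ?_
    rw [List.forall₂_iff_get]
    refine ⟨by simp, fun i h h' => ?_⟩
    simpa using hM ⟨i, by simpa using h⟩
  have hz : ∀ z ∈ Submodule.span R {b | b ∈ H}, ∀ l < p', z.coeff (q - 1 - l) = 0 := by
    intro z hz l hl
    induction hz using Submodule.span_induction with
    | mem x hx => exact hH x hx l hl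
    | zero => simp
    | add x y _ _ hx hy => rw [coeff_add, hx, hy, add_zero]
    | smul c x _ hx => rw [coeff_smul, hx, smul_zero]
  have h2 : topForm R q (wedge (List.ofFn Y)) =
      topForm R q (wedge (List.ofFn fun s => ∑ b, M s b • B b)) := by
    rw [topForm_ofFn, topForm_ofFn]
    congr 1
    ext s l
    have := hz _ (hM s) l l.isLt
    rw [coeff_sub, sub_eq_zero] at this
    exact this
  -- Modulo `H` the list `Y` is `M` times `B`. Thus `M.det` is the ratio both of the exterior
  -- products and of the leading minors, and the cross-multiplied identity needs no division.
  have h3 : wedge (List.ofFn fun s => ∑ b, M s b • B b) =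
      (Matrix.of M).det • wedge (List.ofFn B) := wedge_ofFn_sum_smul (Matrix.of M) B
  rw [h1, h2, h3, map_smul, smul_mul_assoc, smul_smul, smul_eq_mul, mul_comm]

/-- The factors `H j` are replaced by `r • E j` one at a time, from the left. The list `L` is
general because each replaced `E j` is absorbed into it. -/
theorem wedge_mul_wedge_map_of_sub_mem_span {ι : Type*} (l : List ι) (H E : ι → R[X]) (r : R) :
    ∀ L : List R[X], (∀ j ∈ l, H j - r • E j ∈ Submodule.span R {b | b ∈ L}) →
      wedge L * wedge (l.map H) = r ^ l.length • (wedge L * wedge (l.map E)) := by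
  induction l with
  | nil => intro L _; simp
  | cons a l ih =>
    intro L hL
    have h0 := wedge_mul_ι_eq_zero (hL a (by simp))
    rw [map_sub, map_smul, mul_sub, sub_eq_zero, mul_smul_comm] at h0
    have h1 : wedge L * ExteriorAlgebra.ι R (E a) = wedge (L ++ [E a]) := by
      rw [wedge_append, wedge_cons, wedge_nil, mul_one]
    rw [List.map_cons, wedge_cons, ← mul_assoc, h0, h1, smul_mul_assoc, ih, List.map_cons,
      wedge_cons, ← mul_assoc, h1, smul_smul, List.length_cons, pow_succ']
    intro j hj
    refine Submodule.span_mono (fun b hb => ?_) (hL j (by simp [hj]))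
    simp only [Set.mem_ofPred_eq, List.mem_append] at hb ⊢
    exact Or.inl hb

end ExteriorDeterminant

/-! ### Orderings of the rows: blocks and levels -/

section Lists

variable {R : Type*} [CommRing R]

theorem shifts_succ (m : ℕ) (f : R[X]) : shifts (m + 1) f = X ^ m * f :: shifts m f := by
  simp [shifts, List.range_succ]

@[simp] theorem shifts_zero (f : R[X]) : shifts 0 f = [] := rfl

@[simp] theorem length_shifts (m : ℕ) (f : R[X]) : (shifts m f).length = m := by simp [shifts]

theorem shifts_add (m l : ℕ) (f : R[X]) :
    shifts (m + l) f = shifts m (X ^ l * f) ++ shifts l f := by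
  induction m with
  | zero => simp
  | succ m ih =>
    rw [Nat.add_right_comm, shifts_succ, ih, shifts_succ, List.cons_append, pow_add, mul_assoc]

theorem mem_shifts {m : ℕ} {f g : R[X]} : g ∈ shifts m f ↔ ∃ s < m, X ^ s * f = g := by
  simp [shifts]

/-- The concatenation of the lists `X ^ (v j - 1) * f j, …, f j`. -/
noncomputable def blocks {n : ℕ} (v : Fin n → ℕ) (f : Fin n → R[X]) : List R[X] :=
  (List.ofFn fun j => shifts (v j) (f j)).flatten

theorem mem_blocks {n : ℕ} {v : Fin n → ℕ} {f : Fin n → R[X]} {g : R[X]} :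
    g ∈ blocks v f ↔ ∃ j, ∃ s < v j, X ^ s * f j = g := by
  simp only [blocks, List.mem_flatten, List.mem_ofFn]
  constructor
  · rintro ⟨_, ⟨j, rfl⟩, h⟩
    exact ⟨j, mem_shifts.1 h⟩
  · rintro ⟨j, h⟩
    exact ⟨_, ⟨j, rfl⟩, mem_shifts.2 h⟩

@[simp] theorem length_blocks {n : ℕ} (v : Fin n → ℕ) (f : Fin n → R[X]) :
    (blocks v f).length = ∑ j, v j := by
  simp [blocks, List.length_flatten, List.map_ofFn, List.sum_ofFn]

theorem blocks_succ {n : ℕ} (v : Fin (n + 1) → ℕ) (f : Fin (n + 1) → R[X]) :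
    blocks v f = shifts (v 0) (f 0) ++ blocks (fun j => v j.succ) (fun j => f j.succ) := by
  simp [blocks, List.ofFn_succ]

/-- The lists `X ^ s * f 0, X ^ s * f 1, …` for `s = m - 1, …, 0`. -/
noncomputable def levels {n : ℕ} (m : ℕ) (f : Fin n → R[X]) : List R[X] :=
  ((List.range m).reverse.map fun s => (List.ofFn f).map (X ^ s * ·)).flatten

theorem levels_succ {n : ℕ} (m : ℕ) (f : Fin n → R[X]) :
    levels (m + 1) f = (List.ofFn f).map (X ^ m * ·) ++ levels m f := by
  simp [levels, List.range_succ]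

@[simp] theorem levels_zero {n : ℕ} (f : Fin n → R[X]) : levels 0 f = [] := rfl

@[simp] theorem length_levels {n : ℕ} (m : ℕ) (f : Fin n → R[X]) :
    (levels m f).length = m * n := by
  induction m with
  | zero => simp
  | succ m ih => rw [levels_succ]; simp [ih]; ring

theorem mem_levels {n m : ℕ} {f : Fin n → R[X]} {s : ℕ} (hs : s < m) (j : Fin n) :
    X ^ s * f j ∈ levels m f := by
  simp only [levels, List.mem_flatten, List.mem_map]
  exact ⟨_, ⟨s, by simpa using hs, rfl⟩, by simp only [List.mem_map, List.mem_ofFn]; exact ⟨_, ⟨j, rfl⟩, rfl⟩⟩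

/-- Blocks whose lengths are `m` or `m + 1` are sorted by levels at the cost of a sign. -/
theorem exists_sign_blocks {n m : ℕ} {v : Fin n → ℕ} (hv : ∀ j, v j = m ∨ v j = m + 1) :
    ∃ l : List (Fin n), l.length + m * n = ∑ j, v j ∧ ∃ s : ℤˣ, ∀ f : Fin n → R[X],
      wedge (blocks v f) = ((s : ℤ) : R) • (wedge (levels m f) *
        wedge (l.map fun j => X ^ m * f j)) := by
  -- The indices in the incomplete top level. Both orders of the rows are encoded as lists of pairs
  -- `(j, s)`, so that the permutation, and hence the sign, does not depend on `f`.
  let l := (List.finRange n).filter (fun j => v j = m + 1)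
  let i₁ : List (Fin n × ℕ) :=
    (List.finRange n).flatMap fun j => (List.range (v j)).reverse.map fun s => (j, s)
  let i₂ : List (Fin n × ℕ) :=
    (List.range m).reverse.flatMap fun s => (List.finRange n).map fun j => (j, s)
  have e₁ : ∀ f : Fin n → R[X], blocks v f = i₁.map fun x => X ^ x.2 * f x.1 := by
    intro f
    simp only [blocks, i₁, List.ofFn_eq_map, List.flatMap, List.map_flatten, List.map_map, shifts]
    congr 2
    ext1 j
    simp [Function.comp_def]
  have e₂ : ∀ f : Fin n → R[X], levels m f = i₂.map fun x => X ^ x.2 * f x.1 := by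
    intro f
    simp only [levels, i₂, List.ofFn_eq_map, List.flatMap, List.map_flatten, List.map_map]
    congr 2
    ext1 s
    simp [Function.comp_def]
  have hperm : i₁.Perm (i₂ ++ l.map fun j => (j, m)) := by
    rw [List.perm_ext_iff_of_nodup]
    · rintro ⟨j, s⟩
      have : s < v j ↔ s < m ∨ (v j = m + 1 ∧ s = m) := by
        rcases hv j with h | h <;> rw [h] <;> omega
      simp [i₁, i₂, l, this, eq_comm]
    · refine List.nodup_flatMap.2 ⟨fun j _ => ?_, ?_⟩
      · exact (List.nodup_reverse.2 List.nodup_range).map fun a b h => (Prod.mk.inj h).2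
      · refine (List.nodup_finRange n).imp fun {a b} hab => ?_
        intro x hx hx'
        simp only [List.mem_map] at hx hx'
        obtain ⟨_, _, rfl⟩ := hx
        obtain ⟨_, _, h⟩ := hx'
        exact hab (Prod.mk.inj h).1.symm
    · refine List.Nodup.append (List.nodup_flatMap.2 ⟨fun j _ => ?_, ?_⟩) ?_ ?_
      · exact (List.nodup_finRange n).map fun a b h => (Prod.mk.inj h).1
      · refine (List.nodup_reverse.2 List.nodup_range).imp fun {a b} hab => ?_
        intro x hx hx'
        simp only [List.mem_map] at hx hx'
        obtain ⟨_, _, rfl⟩ := hx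
        obtain ⟨_, _, h⟩ := hx'
        exact hab (Prod.mk.inj h).2.symm
      · exact ((List.nodup_finRange n).filter _).map fun a b h => (Prod.mk.inj h).1
      · rintro ⟨j, s⟩ h1 h2
        simp [i₂, l] at h1 h2
        omega
  obtain ⟨s, hs⟩ := exists_sign_wedge_map (R := R) hperm
  refine ⟨l, ?_, s, fun f => ?_⟩
  · have h1 := hperm.length_eq
    have h2 := congrArg List.length (e₁ 0)
    have h3 := congrArg List.length (e₂ 0)
    simp only [length_blocks, length_levels, List.length_map, List.length_append] at h1 h2 h3
    omega
  · rw [e₁, hs, List.map_append, wedge_append, ← e₂, List.map_map, Algebra.smul_def, map_intCast]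
    rfl

end Lists

/-! ### The exchange identity and its iteration -/

section Reduction

variable {R : Type*} [CommRing R] {n : ℕ}

/-- The rows `X ^ (N - 1) * F₀, …, F₀` followed by the blocks of `f`. -/
noncomputable def rowList (F₀ : R[X]) (f : Fin n → R[X]) (w : Fin n → ℕ) (N : ℕ) : List R[X] :=
  shifts N F₀ ++ blocks w f

@[simp] theorem length_rowList (F₀ : R[X]) (f : Fin n → R[X]) (w : Fin n → ℕ) (N : ℕ) :
    (rowList F₀ f w N).length = N + ∑ j, w j := by simp [rowList]

theorem mem_rowList {F₀ : R[X]} {f : Fin n → R[X]} {w : Fin n → ℕ} {N : ℕ} {g : R[X]} :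
    g ∈ rowList F₀ f w N ↔
      (∃ s < N, X ^ s * F₀ = g) ∨ ∃ j, ∃ s < w j, X ^ s * f j = g := by
  rw [rowList, List.mem_append, mem_shifts, mem_blocks]

theorem rowList_subset {F₀ : R[X]} {f : Fin n → R[X]} {w : Fin n → ℕ} {N N' : ℕ} (h : N ≤ N') :
    {b | b ∈ rowList F₀ f w N} ⊆ {b | b ∈ rowList F₀ f w N'} := by
  intro b hb
  rw [Set.mem_ofPred_eq, mem_rowList] at hb ⊢
  exact hb.imp_left fun ⟨s, hs, e⟩ => ⟨s, hs.trans_le h, e⟩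

/-- The properties of the subresultants `G₀`, `H 0, …, H (n - 1)` at `w` and at the `n` vectors
next to `w`, normalized by signs, that determine their exterior products. -/
structure IsReduction (F₀ : R[X]) (f : Fin n → R[X]) (w : Fin n → ℕ) (d₀ N₀ : ℕ) (r : R)
    (G₀ : R[X]) (H : Fin n → R[X]) : Prop where
  sum_le : ∑ j, w j ≤ d₀
  top : ∀ N, N₀ ≤ N → topForm R (d₀ + N) (wedge (rowList F₀ f w N)) = r
  mem_span : G₀ ∈ Submodule.span R {b | b ∈ rowList F₀ f w N₀}
  natDegree_le : G₀.natDegree ≤ d₀ - ∑ j, w j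
  coeff_eq : G₀.coeff (d₀ - ∑ j, w j) = r
  sub_mem_span : ∀ j, H j - r • (X ^ w j * f j) ∈ Submodule.span R {b | b ∈ rowList F₀ f w N₀}
  degree_lt : ∀ j, (H j).degree < (d₀ - ∑ j, w j : ℕ)

theorem topForm_singleton (q : ℕ) (f : R[X]) :
    topForm R q (wedge [f]) = f.coeff (q - 1) := by
  have : [f] = List.ofFn fun _ : Fin 1 => f := by simp
  rw [this, topForm_ofFn, Matrix.det_fin_one]
  simp

namespace IsReduction

variable {K : Type*} [Field K] {F₀ : K[X]} {f : Fin n → K[X]} {w : Fin n → ℕ} {d₀ N₀ : ℕ} {r : K}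
  {G₀ : K[X]} {H : Fin n → K[X]}

/-- Modulo the span of `H`, the list `X * rowList N, G₀` is expressed through `rowList (N + 1)`,
which has the same length. The `H j` vanish in the leading columns, so comparing the minors `r * r`
and `r` gives one factor `r`; replacing each `H j` by `r • (X ^ w j * f j)` gives `r ^ n`. -/
theorem wedge_step (h : IsReduction F₀ f w d₀ N₀ r G₀ H) (hr : r ≠ 0) {N : ℕ} (hN : N₀ ≤ N) :
    wedge ((rowList F₀ f w N).map (X ^ 1 * ·)) * ExteriorAlgebra.ι K G₀ * wedge (List.ofFn H) =
      r ^ (n + 1) • (wedge (rowList F₀ f w (N + 1)) *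
        wedge (List.ofFn fun j => X ^ w j * f j)) := by
  have hle := h.sum_le
  have hsub : ∀ {N' N'' : ℕ}, N' ≤ N'' → Submodule.span K {b | b ∈ rowList F₀ f w N'} ≤
      Submodule.span K {b | b ∈ rowList F₀ f w N''} := fun h => Submodule.span_mono (rowList_subset h)
  have h1 : wedge ((rowList F₀ f w N).map (X ^ 1 * ·)) * ExteriorAlgebra.ι K G₀ =
      wedge ((rowList F₀ f w N).map (X ^ 1 * ·) ++ [G₀]) := by
    rw [wedge_append, wedge_cons, wedge_nil, mul_one]
  have h2 : topForm K (d₀ + N + 1) (wedge ((rowList F₀ f w N).map (X ^ 1 * ·) ++ [G₀])) = r * r := by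
    have hq : d₀ + N + 1 - (N + ∑ j, w j) = d₀ - ∑ j, w j + 1 := by omega
    rw [topForm_append, topForm_map_X_pow_mul, h.top N hN, topForm_singleton, List.length_map,
      length_rowList, hq, Nat.add_sub_cancel, h.coeff_eq]
    · rw [length_rowList]; omega
    · simp only [List.length_map, length_rowList, List.length_singleton]; omega
    · intro g hg
      rw [List.mem_singleton] at hg
      rw [hg, List.length_map, length_rowList, hq]
      refine degree_le_natDegree.trans_lt ?_
      exact_mod_cast Nat.lt_succ_of_le h.natDegree_le
  have h3 : r • (wedge ((rowList F₀ f w N).map (X ^ 1 * ·) ++ [G₀]) * wedge (List.ofFn H)) =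
      (r * r) • (wedge (rowList F₀ f w (N + 1)) * wedge (List.ofFn H)) := by
    rw [← h2, ← h.top (N + 1) (by omega)]
    refine topForm_smul_wedge_mul_wedge (by simp; omega) ?_ ?_
    · intro y hy
      rw [List.mem_append, List.mem_singleton, List.mem_map] at hy
      rcases hy with ⟨g, hg, rfl⟩ | rfl
      · rw [mem_rowList] at hg
        rcases hg with ⟨s, hs, rfl⟩ | ⟨j, s, hs, rfl⟩
        · refine Submodule.mem_sup_left (Submodule.subset_span ?_)
          rw [Set.mem_ofPred_eq, mem_rowList]
          exact Or.inl ⟨s + 1, by omega, by ring⟩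
        · rcases Nat.lt_or_ge (s + 1) (w j) with hs' | hs'
          · refine Submodule.mem_sup_left (Submodule.subset_span ?_)
            rw [Set.mem_ofPred_eq, mem_rowList]
            exact Or.inr ⟨j, s + 1, by omega, by ring⟩
          -- The top row of block `j` leaves the block when multiplied by `X`; it is recovered from
          -- `H j` by inverting `r`.
          · have hw : w j = s + 1 := by omega
            have e : X ^ 1 * (X ^ s * f j) =
                r⁻¹ • (H j - (H j - r • (X ^ w j * f j))) := by
              rw [sub_sub_cancel, smul_smul, inv_mul_cancel₀ hr, one_smul, hw]; ring
            rw [e]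
            refine Submodule.smul_mem _ _ (Submodule.sub_mem _ (Submodule.mem_sup_right
              (Submodule.subset_span (List.mem_ofFn.2 ⟨j, rfl⟩))) (Submodule.mem_sup_left
              (hsub (by omega) (h.sub_mem_span j))))
      · exact Submodule.mem_sup_left (hsub (by omega) h.mem_span)
    · intro g hg l hl
      obtain ⟨j, rfl⟩ := List.mem_ofFn.1 hg
      rw [length_rowList] at hl
      refine coeff_eq_zero_of_degree_lt ((h.degree_lt j).trans_le ?_)
      exact_mod_cast (by omega)
  have h4 : wedge (rowList F₀ f w (N + 1)) * wedge (List.ofFn H) = r ^ n •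
      (wedge (rowList F₀ f w (N + 1)) * wedge (List.ofFn fun j => X ^ w j * f j)) := by
    have := wedge_mul_wedge_map_of_sub_mem_span (List.finRange n) H (fun j => X ^ w j * f j) r
      (rowList F₀ f w (N + 1)) fun j _ => hsub (by omega) (h.sub_mem_span j)
    rwa [← List.ofFn_eq_map, ← List.ofFn_eq_map, List.length_finRange] at this
  rw [mul_smul] at h3
  rw [h1, smul_right_injective _ hr h3, h4, smul_smul, pow_succ']

/-- Induction on `m`: `wedge_step` multiplied by `X ^ m` handles the top level and turns `N` into `N
+ 1`, after which the remaining `m` levels follow. This is why `N` is quantified inside. -/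
theorem wedge_levels (h : IsReduction F₀ f w d₀ N₀ r G₀ H) (hr : r ≠ 0) (m : ℕ) :
    ∀ N, N₀ ≤ N → wedge ((rowList F₀ f w N).map (X ^ m * ·)) * wedge (shifts m G₀) *
      wedge (levels m H) = r ^ (m * (n + 1)) • (wedge (rowList F₀ f w (N + m)) *
        wedge (levels m fun j => X ^ w j * f j)) := by
  induction m with
  | zero => intro N _; simp
  | succ m ih =>
    intro N hN
    set E : Fin n → K[X] := fun j => X ^ w j * f j with hE
    have h1 := congrArg (shiftHom m) (h.wedge_step hr hN)
    simp only [map_mul, map_smul, shiftHom_wedge] at h1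
    have hG : shiftHom m (ExteriorAlgebra.ι K G₀) = ExteriorAlgebra.ι K (X ^ m * G₀) := by
      simp [shiftHom]
    have hmap : ((rowList F₀ f w N).map (X ^ 1 * ·)).map (X ^ m * ·) =
        (rowList F₀ f w N).map (X ^ (m + 1) * ·) := by
      rw [List.map_map]
      refine List.map_congr_left fun a _ => ?_
      simp only [Function.comp]
      ring
    rw [hG, hmap] at h1
    have h2 := ih (N + 1) (by omega)
    rw [levels_succ, levels_succ, wedge_append, wedge_append, shifts_succ, wedge_cons]
    set a := wedge ((rowList F₀ f w N).map (X ^ (m + 1) * ·))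
    set g := ExteriorAlgebra.ι K (X ^ m * G₀)
    have c1 : wedge (shifts m G₀) * wedge ((List.ofFn H).map (X ^ m * ·)) =
        (-1 : K) ^ (m * n) • (wedge ((List.ofFn H).map (X ^ m * ·)) * wedge (shifts m G₀)) := by
      rw [wedge_mul_wedge_smul]; simp
    have c2 : wedge ((List.ofFn E).map (X ^ m * ·)) * (wedge (shifts m G₀) * wedge (levels m H)) =
        wedge (shifts m G₀) * wedge (levels m H) * wedge ((List.ofFn E).map (X ^ m * ·)) := by
      rw [← wedge_append, wedge_mul_wedge_smul]
      have : Even (n * (m + m * n)) := by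
        have := (Nat.even_mul_succ_self n).mul_left m
        convert this using 1
        ring
      simp [this.neg_one_pow]
    have c3 : wedge (levels m E) * wedge ((List.ofFn E).map (X ^ m * ·)) = (-1 : K) ^ (m * n * n) •
        (wedge ((List.ofFn E).map (X ^ m * ·)) * wedge (levels m E)) := by
      rw [wedge_mul_wedge_smul]; simp
    set b := wedge (shifts m G₀)
    set c := wedge (levels m H)
    set x := wedge ((List.ofFn H).map (X ^ m * ·))
    set e := wedge ((List.ofFn E).map (X ^ m * ·))
    set a' := wedge ((rowList F₀ f w (N + 1)).map (X ^ m * ·))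
    have hN1 : N + 1 + m = N + (m + 1) := by ring
    rw [hN1] at h2
    -- The signs from the rearrangements cancel because `n * (n + 1)` is even.
    have hsgn : (-1 : K) ^ (m * n) * (-1) ^ (m * n * n) = 1 := by
      rw [← pow_add]
      refine Even.neg_one_pow ?_
      have := (Nat.even_mul_succ_self n).mul_left m
      convert this using 1
      ring
    calc a * (g * b) * (x * c) = a * g * (b * x) * c := by simp only [mul_assoc]
      _ = (-1 : K) ^ (m * n) • (a * g * x * (b * c)) := by
        rw [c1, mul_smul_comm, smul_mul_assoc]; simp only [mul_assoc]
      _ = ((-1 : K) ^ (m * n) * r ^ (n + 1)) • (a' * (e * (b * c))) := by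
        rw [h1, smul_mul_assoc, smul_smul, mul_assoc]
      _ = ((-1 : K) ^ (m * n) * r ^ (n + 1)) • (a' * b * c * e) := by
        rw [c2]; simp only [mul_assoc]
      _ = ((-1 : K) ^ (m * n) * r ^ (n + 1) * r ^ (m * (n + 1)) * (-1) ^ (m * n * n)) •
          (wedge (rowList F₀ f w (N + (m + 1))) * (e * wedge (levels m E))) := by
        rw [h2, smul_mul_assoc, smul_smul, mul_assoc (wedge (rowList F₀ f w (N + (m + 1)))), c3, mul_smul_comm, smul_smul]
      _ = _ := by
        congr 1
        linear_combination (r ^ (n + 1) * r ^ (m * (n + 1))) * hsgn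

/-- Sorting into levels costs the same sign on both sides. The `m` full levels are covered by
`wedge_levels`; each row of the incomplete level `m` contributes one more factor `r`. -/
theorem wedge_blocks (h : IsReduction F₀ f w d₀ N₀ r G₀ H) (hr : r ≠ 0) {m N : ℕ} (hN : N₀ ≤ N)
    {v : Fin n → ℕ} (hv : ∀ j, v j = m ∨ v j = m + 1) :
    wedge ((rowList F₀ f w N).map (X ^ m * ·)) * wedge (shifts m G₀) * wedge (blocks v H) =
      r ^ (m + ∑ j, v j) • (wedge (rowList F₀ f w (N + m)) *
        wedge (blocks v fun j => X ^ w j * f j)) := by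
  obtain ⟨l, hl, s, hs⟩ := exists_sign_blocks (R := K) hv
  rw [hs, hs, mul_smul_comm, mul_smul_comm, smul_comm (r ^ _)]
  congr 1
  rw [← mul_assoc, h.wedge_levels hr m N hN, ← mul_assoc, ← wedge_append, smul_mul_assoc,
    wedge_mul_wedge_map_of_sub_mem_span l (fun j => X ^ m * H j)
      (fun j => X ^ m * (X ^ w j * f j)) r, smul_smul, ← pow_add, ← hl]
  · congr 2
    ring
  · intro j _
    have e : X ^ m * H j - r • (X ^ m * (X ^ w j * f j)) =
        LinearMap.mulLeft K (X ^ m) (H j - r • (X ^ w j * f j)) := by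
      simp [mul_sub]
    rw [e]
    have hm := Submodule.mem_map_of_mem (f := LinearMap.mulLeft K (X ^ m)) (h.sub_mem_span j)
    rw [Submodule.map_span] at hm
    refine Submodule.span_mono ?_ hm
    rintro _ ⟨g, hg, rfl⟩
    rw [Set.mem_ofPred_eq, mem_rowList] at hg
    rw [Set.mem_ofPred_eq, List.mem_append, mem_rowList, LinearMap.mulLeft_apply]
    rcases hg with ⟨s, hs, rfl⟩ | ⟨j, s, hs, rfl⟩
    · exact Or.inl (Or.inl ⟨m + s, by omega, by ring⟩)
    · rcases Nat.lt_or_ge (m + s) (w j) with hs' | hs'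
      · exact Or.inl (Or.inr ⟨j, m + s, hs', by ring⟩)
      -- A row pushed out of block `j` by `X ^ m` is a shift of `X ^ w j * f j` by less than `m`,
      -- hence already present among the full levels.
      · refine Or.inr ?_
        have e' : X ^ m * (X ^ s * f j) = X ^ (m + s - w j) * (X ^ w j * f j) := by
          rw [← mul_assoc, ← mul_assoc, ← pow_add, ← pow_add, Nat.sub_add_cancel hs']
        rw [e']
        exact mem_levels (f := fun j => X ^ w j * f j) (by omega) j

/-- The determinant polynomial of the shifted rows in terms of the one of the reduced rows. -/
theorem pow_smul_dpForm (h : IsReduction F₀ f w d₀ N₀ r G₀ H) (hr : r ≠ 0) {m N : ℕ} (hN : N₀ ≤ N)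
    {v : Fin n → ℕ} (hv : ∀ j, v j = m ∨ v j = m + 1) (hv0 : 0 < ∑ j, v j)
    (hle : ∑ j, w j + ∑ j, v j ≤ d₀) {e : ℕ} (he : e + 1 = m + ∑ j, v j) :
    r ^ e • dpForm K (d₀ + N + m) (wedge (rowList F₀ f w (N + m) ++
        blocks v fun j => X ^ w j * f j)) =
      dpForm K (d₀ - ∑ j, w j + m) (wedge (shifts m G₀ ++ blocks v H)) := by
  have h1 := congrArg (dpForm K (d₀ + N + m)) (h.wedge_blocks hr hN hv)
  rw [mul_assoc, ← wedge_append, ← wedge_append, ← wedge_append, map_smul] at h1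
  have hq : d₀ + N + m - ((rowList F₀ f w N).map (X ^ m * ·)).length = d₀ - ∑ j, w j + m := by
    simp only [List.length_map, length_rowList]; omega
  -- The shifted rows split off with leading minor `r`, which cancels against one of the `e + 1`
  -- factors.
  rw [dpForm_append, topForm_map_X_pow_mul, h.top N hN, hq, ← he, pow_succ', mul_smul] at h1
  · exact (smul_right_injective _ hr h1).symm
  · rw [length_rowList]; omega
  · intro h0
    have := congrArg List.length h0
    simp only [List.length_append, length_shifts, length_blocks, List.length_nil] at this
    omega
  · simp only [List.length_map, length_rowList, List.length_append, length_shifts, length_blocks]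
    omega
  · rw [hq]
    intro g hg
    rw [List.mem_append, mem_shifts, mem_blocks] at hg
    rcases hg with ⟨s, hs, rfl⟩ | ⟨j, s, hs, rfl⟩
    · rw [degree_mul, degree_X_pow]
      calc (s : WithBot ℕ) + G₀.degree ≤ s + (d₀ - ∑ j, w j : ℕ) := by
            gcongr
            exact degree_le_of_natDegree_le h.natDegree_le
        _ < _ := by exact_mod_cast (by omega)
    · have h2 := h.degree_lt j
      rw [degree_mul, degree_X_pow]
      have hs' : s ≤ m := by rcases hv j with h | h <;> omega
      rcases eq_or_ne (H j) 0 with h0 | h0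
      · rw [h0]; simp
      rw [degree_eq_natDegree h0] at h2 ⊢
      have : (H j).natDegree < d₀ - ∑ j, w j := by exact_mod_cast h2
      exact_mod_cast (by omega)

end IsReduction

end Reduction

/-! ### Signs, scalars and base change for blocks -/

section Signs

variable {R : Type*} [CommRing R]

/-- The sign of moving one row past the blocks `j, …, n - 1` of lengths `w j, …, w (n - 1)`. -/
def sortSign (R : Type*) [CommRing R] {n : ℕ} (w : Fin n → ℕ) (j : Fin n) : R :=
  (-1) ^ ∑ l, if j ≤ l then w l else 0

/-- The top `v j` rows of block `j` move to the end, each past the lower `w l` rows of the blocks `l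
≥ j`. The sign has the form `∏ c j ^ v j`, which is also what `wedge_blocks_smul` produces when the
polynomials are rescaled by signs `c j`. -/
theorem wedge_blocks_add {n : ℕ} (w v : Fin n → ℕ) (f : Fin n → R[X]) :
    wedge (blocks (w + v) f) = (∏ j, sortSign R w j ^ v j) •
      (wedge (blocks w f) * wedge (blocks v fun j => X ^ w j * f j)) := by
  induction n with
  | zero => simp [blocks]
  | succ n ih =>
    have h0 : sortSign R w 0 ^ v 0 = (-1) ^ (v 0 * ∑ j, w j) := by
      rw [sortSign, ← pow_mul, mul_comm]; simp
    have hs : ∀ j : Fin n, sortSign R w j.succ = sortSign R (fun j => w j.succ) j := by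
      intro j
      simp [sortSign, Fin.sum_univ_succ]
    have h1 := ih (fun j => w j.succ) (fun j => v j.succ) (fun j => f j.succ)
    rw [blocks_succ, blocks_succ, blocks_succ v, Pi.add_apply, add_comm (w 0), shifts_add,
      wedge_append, wedge_append, wedge_append, wedge_append]
    change _ * wedge (blocks ((fun j => w j.succ) + fun j => v j.succ) fun j => f j.succ) = _
    rw [h1, Fin.prod_univ_succ]
    simp only [hs]
    have c := wedge_mul_wedge_smul (shifts (v 0) (X ^ w 0 * f 0))
      (shifts (w 0) (f 0) ++ blocks (fun j => w j.succ) fun j => f j.succ)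
    rw [List.length_append, length_shifts, length_shifts, length_blocks, wedge_append,
      ← Fin.sum_univ_succ, ← h0] at c
    rw [mul_smul_comm, mul_comm (sortSign R w 0 ^ v 0), mul_smul]
    congr 1
    rw [← mul_assoc, mul_assoc (wedge (shifts (v 0) _)), c, smul_mul_assoc]
    simp only [mul_assoc]

theorem wedge_shifts_smul (m : ℕ) (c : R) (f : R[X]) :
    wedge (shifts m (c • f)) = c ^ m • wedge (shifts m f) := by
  induction m with
  | zero => simp
  | succ m ih =>
    rw [shifts_succ, shifts_succ, wedge_cons, wedge_cons, ih, mul_smul_comm,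
      mul_smul_comm, map_smul, smul_mul_assoc, smul_smul, pow_succ]

theorem wedge_blocks_smul {n : ℕ} (v : Fin n → ℕ) (c : Fin n → R) (f : Fin n → R[X]) :
    wedge (blocks v fun j => c j • f j) = (∏ j, c j ^ v j) • wedge (blocks v f) := by
  induction n with
  | zero => simp [blocks]
  | succ n ih =>
    rw [blocks_succ, blocks_succ, wedge_append, wedge_append, ih, wedge_shifts_smul,
      Fin.prod_univ_succ, smul_mul_assoc, mul_smul_comm, smul_smul]

theorem blocks_zero {n : ℕ} (f : Fin n → R[X]) : blocks (fun _ => 0) f = [] := by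
  induction n with
  | zero => rfl
  | succ n ih => rw [blocks_succ, ih]; rfl

theorem blocks_unitVec {n : ℕ} (j : Fin n) (f : Fin n → R[X]) :
    blocks (unitVec n j.succ) f = [f j] := by
  induction n with
  | zero => exact j.elim0
  | succ n ih =>
    rw [blocks_succ]
    refine Fin.cases ?_ (fun j => ?_) j
    · have h0 : unitVec (n + 1) (Fin.succ 0) 0 = 1 := by simp [unitVec]
      have h1 : (fun j : Fin n => unitVec (n + 1) (Fin.succ 0) j.succ) = fun _ => 0 := by
        ext j; simp [unitVec, Fin.ext_iff]
      rw [h0, h1, blocks_zero]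
      simp [shifts_succ]
    · have h0 : unitVec (n + 1) j.succ.succ 0 = 0 := by simp [unitVec, Fin.ext_iff]
      have h1 : (fun l : Fin n => unitVec (n + 1) j.succ.succ l.succ) = unitVec n j.succ := by
        ext l; simp [unitVec]
      rw [h0, h1, ih, shifts_zero, List.nil_append]

theorem prod_sortSign_pow_unitVec {n : ℕ} (w : Fin n → ℕ) (j : Fin n) :
    ∏ l, sortSign R w l ^ unitVec n j.succ l = sortSign R w j := by
  rw [Finset.prod_eq_single j]
  · simp [unitVec]
  · intro l _ hl
    simp [unitVec, hl.symm]
  · simp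

theorem map_shifts {S : Type*} [CommRing S] (φ : R →+* S) (m : ℕ) (f : R[X]) :
    (shifts m f).map (Polynomial.map φ) = shifts m (f.map φ) := by
  simp [shifts]

theorem map_blocks {S : Type*} [CommRing S] (φ : R →+* S) {n : ℕ} (v : Fin n → ℕ)
    (f : Fin n → R[X]) :
    (blocks v f).map (Polynomial.map φ) = blocks v fun j => (f j).map φ := by
  simp only [blocks, List.map_flatten, List.map_ofFn, Function.comp_def, map_shifts]

theorem map_rowList {S : Type*} [CommRing S] (φ : R →+* S) {n : ℕ} (F₀ : R[X]) (f : Fin n → R[X])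
    (w : Fin n → ℕ) (N : ℕ) :
    (rowList F₀ f w N).map (Polynomial.map φ) = rowList (F₀.map φ) (fun j => (f j).map φ) w N := by
  rw [rowList, List.map_append, map_shifts, map_blocks, rowList]

end Signs

/-! ### Subresultants as values of `dpForm` -/

section Subresultants

variable {R : Type*} [CommRing R] {n : ℕ}

theorem degree_X_pow_mul_lt {s q : ℕ} {f : R[X]} (h : s + f.natDegree < q) :
    (X ^ s * f).degree < (q : WithBot ℕ) := by
  refine degree_le_natDegree.trans_lt ?_
  have h1 : (X ^ s * f).natDegree ≤ s + f.natDegree :=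
    natDegree_mul_le.trans (Nat.add_le_add_right (natDegree_X_pow_le s) _)
  exact_mod_cast h1.trans_lt h

theorem degree_lt_of_mem_rowList {F₀ : R[X]} {f : Fin n → R[X]} {w : Fin n → ℕ} {N q : ℕ}
    (h₀ : F₀.natDegree + N ≤ q) (hf : ∀ j, 0 < w j → (f j).natDegree + w j ≤ q) :
    ∀ g ∈ rowList F₀ f w N, g.degree < q := by
  intro g hg
  rw [mem_rowList] at hg
  rcases hg with ⟨s, hs, rfl⟩ | ⟨j, s, hs, rfl⟩
  · exact degree_X_pow_mul_lt (by omega)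
  · have := hf j (by omega)
    exact degree_X_pow_mul_lt (by omega)

theorem rowList_succ (F₀ : R[X]) (f : Fin n → R[X]) (w : Fin n → ℕ) (N : ℕ) :
    rowList F₀ f w (N + 1) = [X ^ N * F₀] ++ rowList F₀ f w N := by
  rw [rowList, shifts_succ]; rfl

theorem topForm_X_pow_mul {F₀ : R[X]} (hF : F₀.Monic) (N : ℕ) :
    topForm R (F₀.natDegree + (N + 1)) (wedge [X ^ N * F₀]) = 1 := by
  rw [topForm_singleton, ← add_assoc, Nat.add_sub_cancel, coeff_X_pow_mul, hF.coeff_natDegree]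

/-- For monic `F₀` the leading minor does not depend on the number of rows that come from `F₀`. -/
theorem topForm_rowList_eq {F₀ : R[X]} (hF : F₀.Monic) {f : Fin n → R[X]} {w : Fin n → ℕ}
    {N₀ N : ℕ} (hN : N₀ ≤ N) (hw : ∑ j, w j ≤ F₀.natDegree)
    (hf : ∀ j, 0 < w j → (f j).natDegree + w j ≤ F₀.natDegree + N₀) :
    topForm R (F₀.natDegree + N) (wedge (rowList F₀ f w N)) =
      topForm R (F₀.natDegree + N₀) (wedge (rowList F₀ f w N₀)) := by
  induction N, hN using Nat.le_induction with
  | base => rfl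
  | succ N hN ih =>
    rw [← ih, rowList_succ, topForm_append, topForm_X_pow_mul hF, one_mul]
    · rfl
    · simp only [List.length_singleton, length_rowList]; omega
    · exact degree_lt_of_mem_rowList (by simp only [List.length_singleton]; omega)
        fun j hj => (hf j hj).trans (by simp only [List.length_singleton]; omega)

/-- For monic `F₀` the determinant polynomial does not depend on the number of rows that come
from `F₀`. -/
theorem dpForm_rowList_eq {F₀ : R[X]} (hF : F₀.Monic) {f : Fin n → R[X]} {w : Fin n → ℕ}
    {N₀ N : ℕ} (h₀ : 1 ≤ N₀) (hN : N₀ ≤ N) (hw : ∑ j, w j ≤ F₀.natDegree)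
    (hf : ∀ j, 0 < w j → (f j).natDegree + w j ≤ F₀.natDegree + N₀) :
    dpForm R (F₀.natDegree + N) (wedge (rowList F₀ f w N)) =
      dpForm R (F₀.natDegree + N₀) (wedge (rowList F₀ f w N₀)) := by
  induction N, hN using Nat.le_induction with
  | base => rfl
  | succ N hN ih =>
    rw [← ih, rowList_succ, dpForm_append, topForm_X_pow_mul hF, one_smul]
    · rfl
    · intro h
      have := congrArg List.length h
      rw [length_rowList, List.length_nil] at this
      omega
    · simp only [List.length_singleton, length_rowList]; omega
    · exact degree_lt_of_mem_rowList (by simp only [List.length_singleton]; omega)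
        fun j hj => (hf j hj).trans (by simp only [List.length_singleton]; omega)

/-- The span conditions come from cofactor expansion. The degree bounds hold because the degree is
at most the number of columns minus the number of rows, and `H j` has one row more than `G₀`. -/
theorem isReduction_dpForm {F₀ : R[X]} (hF : F₀.Monic) {f : Fin n → R[X]} {w : Fin n → ℕ}
    {N₀ : ℕ} (h₀ : 1 ≤ N₀) (hw : ∑ j, w j < F₀.natDegree)
    (hf : ∀ j, (f j).natDegree + w j + 1 ≤ F₀.natDegree + N₀) :
    IsReduction F₀ f w F₀.natDegree N₀
      (topForm R (F₀.natDegree + N₀) (wedge (rowList F₀ f w N₀)))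
      (dpForm R (F₀.natDegree + N₀) (wedge (rowList F₀ f w N₀)))
      (fun j => dpForm R (F₀.natDegree + N₀) (wedge (rowList F₀ f w N₀ ++ [X ^ w j * f j]))) := by
  have hne : rowList F₀ f w N₀ ≠ [] := by
    intro h
    have := congrArg List.length h
    rw [length_rowList, List.length_nil] at this
    omega
  have hdeg := degree_lt_of_mem_rowList (F₀ := F₀) (f := f) (w := w) (N := N₀) le_rfl
    fun j _ => by have := hf j; omega
  have hq : F₀.natDegree + N₀ - (rowList F₀ f w N₀).length = F₀.natDegree - ∑ j, w j := by
    rw [length_rowList]; omega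
  refine ⟨hw.le, fun N hN => topForm_rowList_eq hF hN hw.le fun j _ => by have := hf j; omega,
    dpForm_mem_span _ hne (by rw [length_rowList]; omega) hdeg, ?_, ?_, fun j => ?_, fun j => ?_⟩
  · exact (natDegree_dpForm_le _ _).trans hq.le
  · rw [← hq, coeff_dpForm _ hne (by rw [length_rowList]; omega)]
  · exact dpForm_append_singleton_sub_mem_span _ _ (by rw [length_rowList]; omega) hdeg
      (degree_X_pow_mul_lt (by have := hf j; omega))
  · refine degree_le_natDegree.trans_lt ?_
    have h1 := natDegree_dpForm_le (F₀.natDegree + N₀) (rowList F₀ f w N₀ ++ [X ^ w j * f j])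
    rw [List.length_append, length_rowList, List.length_singleton] at h1
    exact_mod_cast (h1.trans_lt (by omega))

theorem numCols_le_iff {L : List R[X]} {q : ℕ} :
    numCols L ≤ q ↔ ∀ f ∈ L, f.natDegree + 1 ≤ q := by
  induction L with
  | nil => simp [numCols]
  | cons a L ih =>
    have : numCols (a :: L) = max (a.natDegree + 1) (numCols L) := rfl
    rw [this, max_le_iff, ih]
    simp

theorem natDegree_add_one_le_numCols {L : List R[X]} {f : R[X]} (hf : f ∈ L) :
    f.natDegree + 1 ≤ numCols L := numCols_le_iff.1 le_rfl f hf

theorem numCols_append (L L' : List R[X]) : numCols (L ++ L') = max (numCols L) (numCols L') := by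
  refine eq_of_forall_ge_iff fun q => ?_
  simp only [max_le_iff, numCols_le_iff, List.mem_append]
  grind

theorem numCols_shifts [Nontrivial R] {f : R[X]} (hf : f ≠ 0) (m : ℕ) :
    numCols (shifts (m + 1) f) = f.natDegree + (m + 1) := by
  refine le_antisymm (numCols_le_iff.2 fun g hg => ?_) ?_
  · obtain ⟨s, hs, rfl⟩ := mem_shifts.1 hg
    rw [natDegree_X_pow_mul _ hf]
    omega
  · have h := natDegree_add_one_le_numCols (mem_shifts.2 ⟨m, Nat.lt_succ_self m, rfl⟩ :
      X ^ m * f ∈ shifts (m + 1) f)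
    rw [natDegree_X_pow_mul _ hf] at h
    omega

/-- Removes the dependence of `deltaZero` on `δ`: all subresultants of the family can be computed
with one common large `N`. -/
theorem subres_eq_dpForm_of_monic [Nontrivial R] {F : Fin (n + 1) → R[X]} (hF : (F 0).Monic)
    (hd : ∀ j : Fin n, (F 0).natDegree ≤ (F j.succ).natDegree) (hpos : 1 ≤ (F 0).natDegree)
    {δ : Fin n → ℕ} (hδ : ∑ j, δ j ≤ (F 0).natDegree) {N : ℕ} (h1 : 1 ≤ N)
    (hN : ∀ j : Fin n, (F j.succ).natDegree + δ j ≤ (F 0).natDegree + N) :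
    subres δ F = dpForm R ((F 0).natDegree + N)
      (wedge (rowList (F 0) (fun j => F j.succ) δ N)) := by
  have hne : ∀ j : Fin n, F j.succ ≠ 0 := by
    intro j h
    have := hd j
    rw [h, natDegree_zero] at this
    omega
  have htail : tailList F δ = blocks δ fun j => F j.succ := rfl
  have hup : numCols (tailList F δ) ≤ (F 0).natDegree + N := by
    rw [numCols_le_iff, htail]
    intro g hg
    obtain ⟨j, s, hs, rfl⟩ := mem_blocks.1 hg
    rw [natDegree_X_pow_mul _ (hne j)]
    have := hN j
    omega
  have hlow : ∀ j, 0 < δ j → (F j.succ).natDegree + δ j ≤ numCols (tailList F δ) := by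
    intro j hj
    have := natDegree_add_one_le_numCols (mem_blocks.2 ⟨j, δ j - 1, by omega, rfl⟩ :
      X ^ (δ j - 1) * F j.succ ∈ blocks δ fun j => F j.succ)
    rw [natDegree_X_pow_mul _ (hne j)] at this
    rw [htail]
    omega
  obtain ⟨N₀, hN₀, hle, hcols, hdeg⟩ : ∃ N₀, deltaZero F δ = N₀ + 1 ∧ N₀ + 1 ≤ N ∧
      numCols (tailList F δ) ≤ (F 0).natDegree + (N₀ + 1) ∧
      ∀ j, 0 < δ j → (F j.succ).natDegree + δ j ≤ (F 0).natDegree + (N₀ + 1) := by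
    by_cases h : ∃ j, 0 < δ j
    · obtain ⟨j, hj⟩ := h
      have h2 := hlow j hj
      have h3 := hd j
      refine ⟨numCols (tailList F δ) - (F 0).natDegree - 1, ?_, by omega, by omega, ?_⟩
      · rw [deltaZero, if_pos (by omega)]
        omega
      · intro l hl
        have := hlow l hl
        omega
    -- For `δ = 0` the tail is empty and has no columns, so `deltaZero` takes its default value `1`.
    · push Not at h
      have h0 : numCols (tailList F δ) = 0 := by
        have : δ = fun _ => 0 := funext fun j => Nat.le_zero.1 (h j)
        rw [htail, this, blocks_zero]
        rfl
      refine ⟨0, ?_, by omega, by omega, fun j hj => absurd (h j) (by omega)⟩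
      rw [deltaZero, if_neg (by omega)]
  have hL : numCols (rowList (F 0) (fun j => F j.succ) δ (N₀ + 1)) =
      (F 0).natDegree + (N₀ + 1) := by
    rw [rowList, numCols_append, numCols_shifts hF.ne_zero, max_eq_left]
    exact hcols
  rw [subres, hN₀, htail, ← rowList, detPoly_coeffMatrix, hL,
    dpForm_rowList_eq hF (by omega) hle hδ hdeg]
  · rw [rowList_succ]; simp
  · rw [hL, length_rowList]; omega

/-- The top row `X ^ m * G j₀.succ` has degree `D - 1 + m`, the maximum over the tail, so the tail
has `D + m` columns and `deltaZero` is `m`. -/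
theorem subres_eq_dpForm_of_natDegree [IsDomain R] {G : Fin (n + 1) → R[X]} {D m : ℕ}
    (hG : (G 0).natDegree = D) (hD : 1 ≤ D) {v : Fin n → ℕ} (hv : ∀ j, v j ≤ m + 1)
    (hle : ∀ j : Fin n, (G j.succ).natDegree ≤ D - 1) (j₀ : Fin n) (hj₀ : v j₀ = m + 1)
    (hne : G j₀.succ ≠ 0) (heq : (G j₀.succ).natDegree = D - 1) (hvD : ∑ j, v j ≤ D) :
    subres v G = dpForm R (D + m) (wedge (shifts m (G 0) ++ blocks v fun j => G j.succ)) := by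
  have htail : tailList G v = blocks v fun j => G j.succ := rfl
  have hcols : numCols (tailList G v) = D + m := by
    refine le_antisymm (numCols_le_iff.2 fun g hg => ?_) ?_
    · rw [htail] at hg
      obtain ⟨j, s, hs, rfl⟩ := mem_blocks.1 hg
      have h1 : (X ^ s * G j.succ).natDegree ≤ s + (G j.succ).natDegree :=
        natDegree_mul_le.trans (Nat.add_le_add_right (natDegree_X_pow_le s) _)
      have := hle j
      have := hv j
      omega
    · have := natDegree_add_one_le_numCols (mem_blocks.2 ⟨j₀, m, by omega, rfl⟩ :
        X ^ m * G j₀.succ ∈ blocks v fun j => G j.succ)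
      rw [natDegree_X_pow_mul _ hne] at this
      rw [htail]
      omega
  have h0 : deltaZero G v = m := by
    rw [deltaZero, hcols, hG, if_pos (by omega)]
    omega
  have hL : numCols (shifts m (G 0) ++ tailList G v) = D + m := by
    rw [numCols_append, hcols, max_eq_right]
    rcases m with _ | m
    · simp [numCols]
    · rw [numCols_shifts, hG]
      rintro h
      rw [h, natDegree_zero] at hG
      omega
  rw [subres, h0, detPoly_coeffMatrix, hL, htail]
  · intro h
    have h1 := congrArg List.length h
    have h2 : v j₀ ≤ ∑ j, v j := Finset.single_le_sum (fun _ _ => Nat.zero_le _) (Finset.mem_univ j₀)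
    simp only [htail, List.length_append, length_shifts, length_blocks, List.length_nil] at h1
    omega
  · rw [hL, htail]
    simp only [List.length_append, length_shifts, length_blocks]
    omega

end Subresultants

/-! ### Nonvanishing of the generic leading minors -/

section Generic

theorem topForm_one {R : Type*} [CommRing R] (q : ℕ) : topForm R q 1 = 1 := by
  have h := topForm_ofFn (R := R) q (Fin.elim0 : Fin 0 → R[X])
  rwa [List.ofFn_zero, wedge_nil, Matrix.det_fin_zero] at h

theorem topForm_shifts_X_pow {R : Type*} [CommRing R] [Nontrivial R] (m a : ℕ) :
    topForm R (a + m) (wedge (shifts m (X ^ a : R[X]))) = 1 := by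
  have h := topForm_rowList_eq (R := R) (monic_X_pow a) (f := Fin.elim0) (w := Fin.elim0)
    (Nat.zero_le m) (by simp) (fun j => j.elim0)
  rw [natDegree_X_pow] at h
  simpa [rowList, blocks, topForm_one] using h

/-- With these exponents the rows are the consecutive monomials `X ^ (c - 1), X ^ (c - 2), …`, so
the leading minor is that of an identity matrix. -/
theorem topForm_blocks_X_pow {R : Type*} [CommRing R] [Nontrivial R] {n : ℕ} (δ : Fin n → ℕ)
    (c : ℕ) (h : ∑ j, δ j ≤ c) :
    topForm R c (wedge (blocks δ fun j => (X ^ (c - ∑ l, if l ≤ j then δ l else 0) : R[X]))) =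
      1 := by
  induction n generalizing c with
  | zero => simp [blocks, topForm_one]
  | succ n ih =>
    rw [Fin.sum_univ_succ] at h
    have e0 : (∑ l, if l ≤ (0 : Fin (n + 1)) then δ l else 0) = δ 0 := by
      simp
    have es : ∀ j : Fin n, c - (∑ l, if l ≤ j.succ then δ l else 0) =
        c - δ 0 - ∑ l, if l ≤ j then δ l.succ else 0 := by
      intro j
      simp [Fin.sum_univ_succ, Nat.sub_add_eq]
    have hc : c - δ 0 + δ 0 = c := by omega
    rw [blocks_succ]
    simp only [e0, es]
    rw [topForm_append, length_shifts, ih _ _ (by omega), mul_one]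
    · conv_lhs => rw [← hc, Nat.add_sub_cancel]
      exact topForm_shifts_X_pow _ _
    · simp only [length_shifts, length_blocks]; omega
    · intro g hg
      obtain ⟨j, s, hs, rfl⟩ := mem_blocks.1 hg
      refine degree_X_pow_mul_lt ?_
      rw [natDegree_X_pow, length_shifts]
      have h1 : δ j.succ ≤ ∑ l, if l ≤ j then δ l.succ else 0 := by
        have := Finset.single_le_sum (f := fun l => if l ≤ j then δ l.succ else 0)
          (fun _ _ => Nat.zero_le _) (Finset.mem_univ j)
        simpa using this
      have h2 : (∑ l, if l ≤ j then δ l.succ else 0) ≤ ∑ l : Fin n, δ l.succ :=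
        Finset.sum_le_sum fun l _ => by split_ifs <;> simp
      omega

variable {n : ℕ}

theorem coeff_genericFamily (d : Fin (n + 1) → ℕ) (i : Fin (n + 1)) (l : ℕ) :
    (genericFamily d i).coeff l =
      if l < d i + 1 then (if i = 0 ∧ l = d 0 then 1 else MvPolynomial.X (i, l)) else 0 := by
  simp only [genericFamily, finsetSum_coeff, coeff_C_mul_X_pow]
  simp

theorem natDegree_genericFamily (d : Fin (n + 1) → ℕ) (i : Fin (n + 1)) :
    (genericFamily d i).natDegree = d i := by
  refine natDegree_eq_of_le_of_coeff_ne_zero ?_ ?_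
  · rw [natDegree_le_iff_coeff_eq_zero]
    intro l hl
    rw [coeff_genericFamily, if_neg (by omega)]
  · rw [coeff_genericFamily, if_pos (by omega)]
    split_ifs
    · exact one_ne_zero
    · exact MvPolynomial.X_ne_zero _

theorem monic_genericFamily (d : Fin (n + 1) → ℕ) : (genericFamily d 0).Monic := by
  rw [Monic, leadingCoeff, natDegree_genericFamily, coeff_genericFamily, if_pos (by omega),
    if_pos ⟨rfl, rfl⟩]

/-- The leading minors of the generic family do not vanish. -/
theorem topForm_genericFamily_ne_zero (d : Fin (n + 1) → ℕ) (hd : ∀ j, d 0 ≤ d j) (δ : Fin n → ℕ)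
    (hδ : ∑ j, δ j ≤ d 0) (N : ℕ) :
    topForm _ (d 0 + N)
      (wedge (rowList (genericFamily d 0) (fun j => genericFamily d j.succ) δ N)) ≠ 0 := by
  -- Specialization to `X ^ d 0` and the monomials `X ^ a j`, chosen so that the blocks continue the
  -- rows of `X ^ d 0` without gaps. It exists because `a j ≤ d 0 ≤ d j.succ`.
  let a : Fin n → ℕ := fun j => d 0 - ∑ l, if l ≤ j then δ l else 0
  let val : Fin (n + 1) × ℕ → ℤ := fun x =>
    Fin.cases (motive := fun _ => ℤ) 0 (fun j => if x.2 = a j then 1 else 0) x.1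
  let φ : MvPolynomial (Fin (n + 1) × ℕ) ℤ →+* ℤ := (MvPolynomial.aeval val).toRingHom
  have hX : ∀ x, φ (MvPolynomial.X x) = val x := fun x => by simp [φ]
  have h0 : (genericFamily d 0).map φ = X ^ d 0 := by
    ext l
    rw [coeff_map, coeff_genericFamily, coeff_X_pow]
    by_cases h1 : l = d 0
    · simp [h1]
    · simp [h1, apply_ite φ, hX, val]
  have hs : ∀ j : Fin n, (genericFamily d j.succ).map φ = X ^ a j := by
    intro j
    ext l
    have := hd j.succ
    have ha : a j ≤ d j.succ := (Nat.sub_le _ _).trans this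
    rw [coeff_map, coeff_genericFamily, coeff_X_pow, if_neg (c := j.succ = 0 ∧ _)
      (fun h => Fin.succ_ne_zero j h.1),
      apply_ite φ, hX, map_zero]
    simp only [val, Fin.cases_succ]
    split_ifs <;> first | rfl | omega
  intro h
  have h1 := congrArg φ h
  rw [map_topForm, map_rowList, h0, map_zero] at h1
  simp only [hs] at h1
  rw [rowList, topForm_append, length_shifts, topForm_shifts_X_pow, Nat.add_sub_cancel,
    topForm_blocks_X_pow δ _ hδ] at h1
  · norm_num at h1
  · simp only [length_shifts, length_blocks]; omega
  · intro g hg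
    obtain ⟨j, s, hs, rfl⟩ := mem_blocks.1 hg
    refine degree_X_pow_mul_lt ?_
    rw [natDegree_X_pow, length_shifts]
    have h1 : δ j ≤ ∑ l, if l ≤ j then δ l else 0 := by
      have := Finset.single_le_sum (f := fun l => if l ≤ j then δ l else 0)
        (fun _ _ => Nat.zero_le _) (Finset.mem_univ j)
      simpa using this
    have h2 : (∑ l, if l ≤ j then δ l else 0) ≤ ∑ l : Fin n, δ l :=
      Finset.sum_le_sum fun l _ => by split_ifs <;> simp
    simp only [a]
    omega

end Generic

/-! ### The composition formula over a domain -/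

section Domain

/-- The composition formula for determinant polynomials over a domain. -/
theorem pow_smul_dpForm_of_isDomain {R : Type*} [CommRing R] [IsDomain R] {n : ℕ} {F₀ : R[X]}
    (hF : F₀.Monic) {f : Fin n → R[X]} {w v : Fin n → ℕ} {m N e : ℕ} (h₀ : 1 ≤ N)
    (hf : ∀ j, (f j).natDegree + w j + 1 ≤ F₀.natDegree + N)
    (hr : topForm R (F₀.natDegree + N) (wedge (rowList F₀ f w N)) ≠ 0)
    (hv : ∀ j, v j = m ∨ v j = m + 1) (hv0 : 0 < ∑ j, v j)
    (hle : ∑ j, w j + ∑ j, v j ≤ F₀.natDegree) (he : e + 1 = m + ∑ j, v j) :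
    topForm R (F₀.natDegree + N) (wedge (rowList F₀ f w N)) ^ e •
        dpForm R (F₀.natDegree + N + m) (wedge (rowList F₀ f w (N + m) ++
          blocks v fun j => X ^ w j * f j)) =
      dpForm R (F₀.natDegree - ∑ j, w j + m)
        (wedge (shifts m (dpForm R (F₀.natDegree + N) (wedge (rowList F₀ f w N))) ++
          blocks v fun j => dpForm R (F₀.natDegree + N)
            (wedge (rowList F₀ f w N ++ [X ^ w j * f j])))) := by
  -- The exchange argument inverts the leading minor, while the resulting identity has no
  -- denominators and descends along the injection `φ`.
  let φ := algebraMap R (FractionRing R)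
  have hφ : Function.Injective φ := IsFractionRing.injective R (FractionRing R)
  have hdeg : ∀ g : R[X], (g.map φ).natDegree = g.natDegree := natDegree_map_eq_of_injective hφ
  have h := isReduction_dpForm (hF.map φ) (f := fun j => (f j).map φ) (w := w) h₀
    (by rw [hdeg]; omega) (fun j => by rw [hdeg, hdeg]; exact hf j)
  have h1 := h.pow_smul_dpForm (m := m) (N := N) ?_ le_rfl hv hv0 (by rwa [hdeg]) he
  · apply map_injective φ hφ
    rw [hdeg] at h1
    simp only [Polynomial.map_smul, map_dpForm, map_pow, map_topForm, List.map_append, map_rowList,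
      map_blocks, map_shifts, List.map_cons, List.map_nil, Polynomial.map_mul, Polynomial.map_pow,
      map_X]
    exact h1
  · rw [hdeg, ← map_rowList, ← map_topForm]
    exact (map_ne_zero_iff φ hφ).2 hr


/-- The composition formula for a family with monic `F 0` whose leading minors do not vanish. -/
theorem C_princCoeff_pow_mul_subres {R : Type*} [CommRing R] [IsDomain R] {n : ℕ} (hn : 1 ≤ n)
    {d : Fin (n + 1) → ℕ} (hd : ∀ j, d 0 ≤ d j) {F : Fin (n + 1) → R[X]} (hF : (F 0).Monic)
    (hdeg : ∀ j, (F j).natDegree = d j)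
    (hne : ∀ δ : Fin n → ℕ, ∑ j, δ j ≤ d 0 → ∀ N,
      topForm R (d 0 + N) (wedge (rowList (F 0) (fun j => F j.succ) δ N)) ≠ 0)
    {k : ℕ} (hk : 1 ≤ k) (i : Fin (n + 1))
    {w : Fin (n + 1) → Fin n → ℕ} {v u : Fin n → ℕ} {ε : ℕ}
    (hw : ∀ j, w j = w 0 + unitVec n j)
    (hv : v = (fun _ => k) + unitVec n i)
    (hu : u = w 0 + v) (huP : u ∈ indexSet (d 0) n)
    (hε : ε + 2 = (∑ j, (v + unitVec n i) j) + k) :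
    C (princCoeff (w 0) F) ^ ε * subres u F = subres v (fun j => subres (w j) F) := by

  have hsum : ∑ j, w 0 j + ∑ j, v j ≤ d 0 := by
    rw [← Finset.sum_add_distrib]
    have h : ∑ j, u j ≤ d 0 := huP
    rwa [hu] at h
  -- Here `m` is one less than the largest entry of `v`: `k - 1` if `i = 0` and `k` otherwise. In
  -- both cases `ε + 1 = m + |v|`, the exponent of `wedge_blocks`.
  obtain ⟨m, hm, j₀, hj₀, he⟩ : ∃ m, (∀ j, v j = m ∨ v j = m + 1) ∧ ∃ j₀, v j₀ = m + 1 ∧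
      ε + 1 = m + ∑ j, v j := by
    simp only [Pi.add_apply, Finset.sum_add_distrib] at hε
    refine Fin.cases (fun hv hε => ?_) (fun i hv hε => ?_) i hv hε
    · have h0 : ∀ j, unitVec n 0 j = 0 := fun j => by simp [unitVec, Fin.ext_iff]
      refine ⟨k - 1, fun j => ?_, ⟨0, hn⟩, ?_, ?_⟩
      · rw [hv, Pi.add_apply, h0]; omega
      · rw [hv, Pi.add_apply, h0]; omega
      · simp only [h0, Finset.sum_const_zero] at hε
        omega
    · have h1 : ∑ j, unitVec n i.succ j = 1 := by simp [unitVec]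
      refine ⟨k, fun j => ?_, i, ?_, ?_⟩
      · rw [hv, Pi.add_apply, unitVec]; split_ifs <;> simp
      · simp [hv, unitVec]
      · rw [h1] at hε
        omega
  have hvpos : ∀ j, v j ≤ ∑ j, v j := fun j =>
    Finset.single_le_sum (fun _ _ => Nat.zero_le _) (Finset.mem_univ j)
  have hv1 : ∀ j, 1 ≤ v j := fun j => by rw [hv, Pi.add_apply]; omega
  have hv0 : 0 < ∑ j, v j := by have := hvpos j₀; omega
  set f : Fin n → R[X] := fun j => F j.succ with hfdef
  obtain ⟨N, hN1, hN⟩ : ∃ N, 1 ≤ N ∧ ∀ j : Fin n, d j.succ + u j ≤ d 0 + N := by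
    refine ⟨1 + ∑ j : Fin n, (d j.succ + u j), by omega, fun j => ?_⟩
    have := Finset.single_le_sum (f := fun j : Fin n => d j.succ + u j)
      (fun _ _ => Nat.zero_le _) (Finset.mem_univ j)
    omega
  have huj : ∀ j, u j = w 0 j + v j := fun j => by rw [hu]; rfl
  have hsub : ∀ (δ : Fin n → ℕ) (N' : ℕ), N ≤ N' → (∑ j, δ j ≤ d 0) → (∀ j, δ j ≤ u j) →
      subres δ F = dpForm R (d 0 + N') (wedge (rowList (F 0) f δ N')) := by
    intro δ N' hN' hδ hδu
    rw [← hdeg 0]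
    refine subres_eq_dpForm_of_monic hF (fun j => ?_) ?_ ?_ (by omega) (fun j => ?_)
    · rw [hdeg, hdeg]; exact hd _
    · rw [hdeg]; omega
    · rwa [hdeg]
    · rw [hdeg, hdeg]
      have := hN j
      have := hδu j
      omega
  have hlen : ∀ δ : Fin n → ℕ, rowList (F 0) f δ N ≠ [] := by
    intro δ h
    have := congrArg List.length h
    rw [length_rowList, List.length_nil] at this
    omega
  have hpc : ∀ δ : Fin n → ℕ, (∑ j, δ j ≤ d 0) → (∀ j, δ j ≤ u j) →
      (subres δ F).coeff (d 0 - ∑ j, δ j) =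
        topForm R (d 0 + N) (wedge (rowList (F 0) f δ N)) := by
    intro δ hδ hδu
    have := coeff_dpForm (q := d 0 + N) (rowList (F 0) f δ N) (hlen δ)
      (by rw [length_rowList]; omega)
    rw [← this, hsub δ N le_rfl hδ hδu, length_rowList]
    congr 1
    omega
  -- The nonvanishing minors fix the exact degrees of the inner subresultants, which determine the
  -- size of the outer matrix.
  have hnd : ∀ δ : Fin n → ℕ, (∑ j, δ j ≤ d 0) → (∀ j, δ j ≤ u j) →
      (subres δ F).coeff (d 0 - ∑ j, δ j) ≠ 0 ∧ (subres δ F).natDegree = d 0 - ∑ j, δ j := by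
    intro δ hδ hδu
    have h1 : (subres δ F).coeff (d 0 - ∑ j, δ j) ≠ 0 := by
      rw [hpc δ hδ hδu]
      exact hne δ hδ N
    refine ⟨h1, natDegree_eq_of_le_of_coeff_ne_zero ?_ h1⟩
    rw [hsub δ N le_rfl hδ hδu]
    refine (natDegree_dpForm_le _ _).trans ?_
    rw [length_rowList]
    omega
  have hw0le : ∑ j, w 0 j ≤ d 0 := by omega
  have hw0u : ∀ j, w 0 j ≤ u j := fun j => by rw [huj]; omega
  have hwj : ∀ j : Fin n, ∑ l, w j.succ l = ∑ l, w 0 l + 1 := by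
    intro j
    rw [hw]
    simp [Finset.sum_add_distrib, unitVec]
  have hwju : ∀ j l, w j l ≤ u l := by
    intro j l
    rw [hw, huj, Pi.add_apply]
    have := hv1 l
    have h1 : unitVec n j l ≤ 1 := by rw [unitVec]; split_ifs <;> simp
    omega
  have hGj : ∀ j : Fin n, subres (w j.succ) F = sortSign R (w 0) j •
      dpForm R (d 0 + N) (wedge (rowList (F 0) f (w 0) N ++ [X ^ w 0 j * f j])) := by
    intro j
    rw [hsub _ N le_rfl (by rw [hwj]; omega) (hwju _), hw j.succ, rowList, wedge_append,
      wedge_blocks_add, prod_sortSign_pow_unitVec, blocks_unitVec, mul_smul_comm, map_smul,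
      ← mul_assoc, ← wedge_append, ← wedge_append, rowList]
  have hR : subres u F = (∏ j, sortSign R (w 0) j ^ v j) • dpForm R (d 0 + N + m)
      (wedge (rowList (F 0) f (w 0) (N + m) ++ blocks v fun j => X ^ w 0 j * f j)) := by
    rw [hsub u (N + m) (by omega) huP (fun _ => le_rfl), hu, rowList, wedge_append,
      wedge_blocks_add, mul_smul_comm, map_smul, ← mul_assoc, ← wedge_append, ← wedge_append,
      rowList, add_assoc]
  have hG : subres v (fun j => subres (w j) F) = dpForm R (d 0 - ∑ j, w 0 j + m)
      (wedge (shifts m (subres (w 0) F) ++ blocks v fun j => subres (w j.succ) F)) := by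
    have h1 := hnd (w j₀.succ) (by rw [hwj]; omega) (hwju _)
    refine subres_eq_dpForm_of_natDegree (G := fun j => subres (w j) F)
      (D := d 0 - ∑ j, w 0 j) (hnd (w 0) hw0le hw0u).2 (by omega)
      (fun j => by rcases hm j with h | h <;> omega) (fun j => ?_) j₀ hj₀ ?_ ?_ (by omega)
    · have h2 := (hnd (w j.succ) (by rw [hwj]; omega) (hwju _)).2
      rw [hwj] at h2
      exact h2.le.trans (by omega)
    · intro h0
      exact h1.1 (by rw [h0, coeff_zero])
    · have h2 := h1.2
      rw [hwj] at h2
      exact h2.trans (by omega)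
  have key := pow_smul_dpForm_of_isDomain hF (f := f) (w := w 0) (v := v) (m := m) (N := N)
    (e := ε) hN1 (fun j => by
      rw [hfdef, hdeg, hdeg]
      have := hN j
      have := huj j
      have := hv1 j
      omega) (by rw [hdeg]; exact hne _ hw0le N) hm hv0
    (by rwa [hdeg]) he
  rw [hdeg] at key
  -- The sign of `hR` on the left matches the one that `hGj` produces on the right through
  -- multilinearity.
  rw [princCoeff, hdeg, hpc _ hw0le hw0u, ← C_pow, ← smul_eq_C_mul, hR, smul_comm, key, hG]
  simp only [hGj]
  rw [wedge_append, wedge_append, wedge_blocks_smul, mul_smul_comm, map_smul,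
    hsub _ N le_rfl hw0le hw0u]

end Domain

theorem mainTheorem1 (n : ℕ) (hn : 1 ≤ n) (d : Fin (n + 1) → ℕ) (hd : ∀ j, d 0 ≤ d j)
    (k : ℕ) (hk : 1 ≤ k) (i : Fin (n + 1))
    (w : Fin (n + 1) → Fin n → ℕ) (v u : Fin n → ℕ) (ε : ℕ)
    (hw : ∀ j, w j = w 0 + unitVec n j)
    (hv : v = (fun _ => k) + unitVec n i)
    (hu : u = w 0 + v) (huP : u ∈ indexSet (d 0) n)
    (hε : ε + 2 = (∑ j, (v + unitVec n i) j) + k) :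
    C (princCoeff (w 0) (genericFamily d)) ^ ε * subres u (genericFamily d) =
      subres v (fun j => subres (w j) (genericFamily d)) :=
  C_princCoeff_pow_mul_subres hn hd (monic_genericFamily d) (natDegree_genericFamily d)
    (topForm_genericFamily_ne_zero d hd) hk i hw hv hu huP hε
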